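/- Let $k$ be a field with $\operatorname{char}(k)\neq 2$ and let $X$ be the hyperelliptic curve of genus $3$ over $k$ given by $y^2=f(x)$, where $f\in k[x]$ has degree $7$ or $8$ and has no repeated roots in an algebraic closure of $k$; that is, $X$ is the smooth projective curve with this affine equation. Let $\iota$ be the hyperelliptic involution $(x,y)\mapsto(x,-y)$, and let $J$ be the Jacobian of $X$. Points of $X$ and $J$ and divisors on $X$ are taken over an algebraically closed field $K\supseteq k$, so that $J(K)=\operatorname{Pic}^0(X_K)$ is the group of divisor classes of degree $0$ on $X_K$. Put $D_\infty=2(\infty)$ if $\deg f=7$, where $\infty$ is the unique point at infinity, and $D_\infty=(\infty_1)+(\infty_2)$ if $\deg f=8$, where $\infty_1\ne\infty_2$ are the two points at infinity. A divisor $D$ on $X$ is called in general position if it is effective and there is no point $P\in X$ such that $D\geq (P)+(\iota(P))$. For every $Q\in J\setminus\{0\}$, exactly one of the following holds: (a) $Q=[D_Q-2D_\infty]$ for some divisor $D_Q$ of degree $4$ in general position; (b) $Q=[D_Q-D_\infty]$ for some divisor $D_Q$ of degree $2$ in general position. In case (b), the divisor $D_Q$ is uniquely determined by $Q$. -/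

import Mathlib

open Polynomial IsDedekindDomain
open scoped WithZero

noncomputable section

namespace HyperellipticCurve

/-! ### Affine charts `v² = g(u)` -/

/-- The conditions on `g` under which the affine curve `v² = g(u)` over `K` has a
(normal, integral) coordinate ring: `char K ≠ 2` and `g` is squarefree and nonconstant. -/
class IsChartPoly {K : Type*} [Field K] (g : K[X]) : Prop where
  two_ne_zero : (2 : K) ≠ 0
  squarefree : Squarefree g
  not_isUnit : ¬ IsUnit g

/-- The coordinate ring `K[u, v] / (v² - g(u))`. -/
abbrev CoordRing {K : Type*} [Field K] (g : K[X]) : Type _ :=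
  AdjoinRoot ((X : K[X][X]) ^ 2 - C g)

/-- The coordinate function `v` on the curve `v² = g(u)`. -/
abbrev CoordRing.v {K : Type*} [Field K] (g : K[X]) : CoordRing g :=
  AdjoinRoot.root _

/-- The function field of the curve `v² = g(u)`. -/
abbrev FunField {K : Type*} [Field K] (g : K[X]) : Type _ :=
  FractionRing (CoordRing g)

section Chart

variable {K : Type*} [Field K] (g : K[X])

lemma monic_chart : ((X : K[X][X]) ^ 2 - C g).Monic := monic_X_pow_sub_C g two_ne_zero

lemma degree_chart : ((X : K[X][X]) ^ 2 - C g).degree ≠ 0 := by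
  rw [degree_X_pow_sub_C (by norm_num)]; norm_num

lemma CoordRing.v_sq : CoordRing.v g ^ 2 = algebraMap K[X] (CoordRing g) g := by
  have h := AdjoinRoot.eval₂_root ((X : K[X][X]) ^ 2 - C g)
  rw [eval₂_sub, eval₂_pow, eval₂_X, eval₂_C, sub_eq_zero] at h
  exact h

lemma CoordRing.exists_rep (a : CoordRing g) : ∃ p q : K[X],
    a = algebraMap K[X] (CoordRing g) p + algebraMap K[X] (CoordRing g) q * CoordRing.v g := by
  induction a using AdjoinRoot.induction_on with
  | ih a =>
    rw [← AdjoinRoot.aeval_eq]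
    induction a using Polynomial.induction_on' with
    | add a b ha hb =>
      obtain ⟨p, q, h⟩ := ha
      obtain ⟨p', q', h'⟩ := hb
      exact ⟨p + p', q + q', by rw [map_add, h, h']; simp only [map_add]; ring⟩
    | monomial n c =>
      rw [aeval_monomial]
      obtain ⟨m, rfl | rfl⟩ := Nat.even_or_odd' n
      · refine ⟨c * g ^ m, 0, ?_⟩
        change algebraMap K[X] (CoordRing g) c * CoordRing.v g ^ (2 * m) = _
        rw [pow_mul, CoordRing.v_sq]; simp only [map_mul, map_pow, map_zero]; ring
      · refine ⟨0, c * g ^ m, ?_⟩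
        change algebraMap K[X] (CoordRing g) c * CoordRing.v g ^ (2 * m + 1) = _
        rw [pow_succ (CoordRing.v g), pow_mul, CoordRing.v_sq]; simp only [map_mul, map_pow, map_zero]; ring

lemma algebraMap_chart_injective : Function.Injective (algebraMap K[X] (CoordRing g)) :=
  AdjoinRoot.of.injective_of_degree_ne_zero (degree_chart g)

instance : FaithfulSMul K[X] (CoordRing g) :=
  (faithfulSMul_iff_algebraMap_injective _ _).2 (algebraMap_chart_injective g)

instance : Algebra.IsIntegral K[X] (CoordRing g) := by
  refine ⟨fun a => ?_⟩
  have hv : IsIntegral K[X] (CoordRing.v g) := AdjoinRoot.isIntegral_root' (monic_chart g)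
  obtain ⟨p, q, rfl⟩ := CoordRing.exists_rep g a
  exact isIntegral_algebraMap.add (isIntegral_algebraMap.mul hv)

/-- The involution `(u, v) ↦ (u, -v)` on the coordinate ring. -/
def CoordRing.conj : CoordRing g →ₐ[K[X]] CoordRing g :=
  AdjoinRoot.liftAlgHom _ (Algebra.ofId _ _) (-CoordRing.v g) (by
    have h := CoordRing.v_sq g
    rw [eval₂_sub, eval₂_pow, eval₂_X, eval₂_C, neg_sq, h]
    exact sub_self _)

lemma CoordRing.conj_v : CoordRing.conj g (CoordRing.v g) = -CoordRing.v g :=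
  AdjoinRoot.liftAlgHom_root _ _ _ _

lemma CoordRing.conj_conj (a : CoordRing g) : CoordRing.conj g (CoordRing.conj g a) = a := by
  obtain ⟨p, q, rfl⟩ := CoordRing.exists_rep g a
  simp only [map_add, map_mul, AlgHom.commutes, CoordRing.conj_v, map_neg, neg_neg]

variable [IsChartPoly g]

instance : IsDomain (CoordRing g) := by
  refine AdjoinRoot.isDomain_of_prime (Irreducible.prime ?_)
  have hd : ((X : K[X][X]) ^ 2 - C g).natDegree = 2 := natDegree_X_pow_sub_C
  rw [(monic_chart g).irreducible_iff_roots_eq_zero_of_degree_le_three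
    (by rw [hd]) (by rw [hd]; norm_num)]
  refine Multiset.eq_zero_of_forall_notMem fun r hr => ?_
  have h := (mem_roots'.1 hr).2
  simp only [IsRoot, eval_sub, eval_pow, eval_X, eval_C, sub_eq_zero] at h
  have hu : IsUnit r := IsChartPoly.squarefree (g := g) r ⟨1, by rw [← h]; ring⟩
  exact IsChartPoly.not_isUnit (g := g) (h ▸ hu.pow 2)

instance : Ring.DimensionLEOne (CoordRing g) := by
  refine ⟨fun {P} hP0 hP => ?_⟩
  have h1 : P.comap (algebraMap K[X] (CoordRing g)) ≠ ⊥ :=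
    mt Ideal.eq_bot_of_comap_eq_bot hP0
  have h2 : (P.comap (algebraMap K[X] (CoordRing g))).IsMaximal :=
    (hP.comap (algebraMap K[X] (CoordRing g))).isMaximal h1
  exact Ideal.isMaximal_of_isIntegral_of_isMaximal_comap P h2

lemma dvd_of_isIntegral {L : Type*} [Field L] [Algebra K[X] L] [FaithfulSMul K[X] L] (p q : K[X])
    (hq : q ≠ 0) (h : IsIntegral K[X] (algebraMap K[X] L p / algebraMap K[X] L q)) : q ∣ p := by
  let := FractionRing.liftAlgebra K[X] L
  have e : algebraMap K[X] L p / algebraMap K[X] L q =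
      algebraMap (FractionRing K[X]) L
        (algebraMap K[X] (FractionRing K[X]) p / algebraMap K[X] (FractionRing K[X]) q) := by
    rw [map_div₀, ← IsScalarTower.algebraMap_apply, ← IsScalarTower.algebraMap_apply]
  rw [e] at h
  have h' := (isIntegral_algebraMap_iff (algebraMap (FractionRing K[X]) L).injective).1 h
  obtain ⟨r, hr⟩ := IsIntegrallyClosed.isIntegral_iff.1 h'
  have hq' : algebraMap K[X] (FractionRing K[X]) q ≠ 0 :=
    (map_ne_zero_iff _ (IsFractionRing.injective _ _)).2 hq
  rw [eq_div_iff hq', ← map_mul] at hr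
  exact ⟨r, by rw [mul_comm]; exact (IsFractionRing.injective K[X] (FractionRing K[X]) hr).symm⟩

lemma dvd_of_sq_dvd {g : K[X]} (hg : Squarefree g) {q b : K[X]} (hq : q ≠ 0)
    (h : q ^ 2 ∣ b ^ 2 * g) : q ∣ b := by
  classical
  by_cases hb : b = 0
  · exact hb ▸ dvd_zero q
  obtain ⟨d, q', b', hco, rfl, rfl⟩ : ∃ d q' b' : K[X], IsCoprime q' b' ∧ q = d * q' ∧ b = d * b' := by
    obtain ⟨q', hq'⟩ := EuclideanDomain.gcd_dvd_left q b
    obtain ⟨b', hb'⟩ := EuclideanDomain.gcd_dvd_right q b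
    have hd : EuclideanDomain.gcd q b ≠ 0 := fun h0 => hq (EuclideanDomain.gcd_eq_zero_iff.1 h0).1
    refine ⟨EuclideanDomain.gcd q b, q', b', ?_, hq', hb'⟩
    refine ⟨EuclideanDomain.gcdA q b, EuclideanDomain.gcdB q b, mul_left_cancel₀ hd ?_⟩
    have hB := EuclideanDomain.gcd_eq_gcd_ab q b
    calc _ = (EuclideanDomain.gcd q b * q') * EuclideanDomain.gcdA q b
          + (EuclideanDomain.gcd q b * b') * EuclideanDomain.gcdB q b := by ring
      _ = _ := by rw [← hq', ← hb', ← hB, mul_one]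
  have hd : d ≠ 0 := left_ne_zero_of_mul hq
  have h1 : q' ^ 2 ∣ b' ^ 2 * g := by
    rw [mul_pow, mul_pow, mul_assoc] at h
    exact (mul_dvd_mul_iff_left (pow_ne_zero 2 hd)).1 h
  have h2 : q' ^ 2 ∣ g := (hco.pow (m := 2) (n := 2)).dvd_of_dvd_mul_left h1
  have hu : IsUnit q' := hg q' (by rwa [← sq])
  exact mul_dvd_mul_left d hu.dvd

instance : IsIntegrallyClosed (CoordRing g) := by
  rw [isIntegrallyClosed_iff (FunField g)]
  intro h hh
  have hh : IsIntegral K[X] h := isIntegral_trans h hh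
  have two0 : (C (2 : K)) ≠ 0 := C_ne_zero.2 (IsChartPoly.two_ne_zero (g := g))
  have two_u : IsUnit (C (2 : K)) := isUnit_C.2 (IsChartPoly.two_ne_zero (g := g)).isUnit
  have inj : Function.Injective (algebraMap K[X] (FunField g)) := by
    rw [IsScalarTower.algebraMap_eq K[X] (CoordRing g) (FunField g)]
    exact (IsFractionRing.injective (CoordRing g) (FunField g)).comp (algebraMap_chart_injective g)
  have : FaithfulSMul K[X] (FunField g) := (faithfulSMul_iff_algebraMap_injective _ _).2 inj
  have cinj : Function.Injective (CoordRing.conj g) :=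
    Function.LeftInverse.injective (CoordRing.conj_conj g)
  -- write `h = (A + B v) / q` with `A`, `B`, `q` polynomials
  obtain ⟨A, B, q, hq, rfl⟩ : ∃ A B q : K[X], q ≠ 0 ∧
      h = algebraMap (CoordRing g) (FunField g) (algebraMap _ _ A + algebraMap _ _ B * CoordRing.v g)
        / algebraMap K[X] (FunField g) q := by
    obtain ⟨a, b, hb, rfl⟩ := IsFractionRing.div_surjective (A := CoordRing g) h
    have hb : b ≠ 0 := nonZeroDivisors.ne_zero hb
    have hcb : CoordRing.conj g b ≠ 0 := (map_ne_zero_iff _ cinj).2 hb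
    obtain ⟨s, t, hst⟩ := CoordRing.exists_rep g b
    obtain ⟨A, B, hAB⟩ := CoordRing.exists_rep g (a * CoordRing.conj g b)
    have hN : b * CoordRing.conj g b = algebraMap K[X] _ (s ^ 2 - t ^ 2 * g) := by
      rw [hst]
      simp only [map_add, map_mul, AlgHom.commutes, CoordRing.conj_v, map_sub, map_pow]
      rw [← CoordRing.v_sq]; ring
    have hN0 : s ^ 2 - t ^ 2 * g ≠ 0 := by
      intro h0
      rw [h0, map_zero] at hN
      exact (mul_ne_zero hb hcb) hN
    refine ⟨A, B, _, hN0, ?_⟩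
    rw [IsScalarTower.algebraMap_apply K[X] (CoordRing g) (FunField g), ← hN, ← hAB, map_mul, map_mul]
    rw [mul_div_mul_right]
    exact (map_ne_zero_iff _ (IsFractionRing.injective _ _)).2 hcb
  set φ := algebraMap K[X] (FunField g) with hφ
  set w := algebraMap (CoordRing g) (FunField g) (CoordRing.v g) with hw
  have hq' : φ q ≠ 0 := (map_ne_zero_iff _ inj).2 hq
  have htow : ∀ p, algebraMap (CoordRing g) (FunField g) (algebraMap K[X] _ p) = φ p :=
    fun p => (IsScalarTower.algebraMap_apply K[X] (CoordRing g) (FunField g) p).symm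
  have hw2 : w ^ 2 = φ g := by rw [hw, ← map_pow, CoordRing.v_sq, htow]
  rw [map_add, map_mul, htow, htow] at hh ⊢
  -- the conjugate is integral as well
  have cinj' : Function.Injective
      ((Algebra.algHom K[X] (CoordRing g) (FunField g)).comp (CoordRing.conj g)) :=
    (IsFractionRing.injective (CoordRing g) (FunField g)).comp cinj
  let σ : FunField g →ₐ[K[X]] FunField g := IsFractionRing.liftAlgHom cinj'
  have hσw : σ w = -w := by
    rw [hw, IsFractionRing.liftAlgHom_apply, IsFractionRing.lift_algebraMap]
    change algebraMap (CoordRing g) (FunField g) (CoordRing.conj g (CoordRing.v g)) = _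
    rw [CoordRing.conj_v, map_neg]
  have hσφ : ∀ p, σ (φ p) = φ p := fun p => σ.commutes p
  rw [← hw] at hh ⊢
  have hc := hh.map σ
  rw [map_div₀, map_add, map_mul, hσφ, hσφ, hσφ, hσw] at hc
  have hA : q ∣ A := by
    have h1 := hh.add hc
    have h2 : q ∣ C 2 * A := by
      refine dvd_of_isIntegral (L := FunField g) _ q hq ?_
      have h2 : φ (C 2) = 2 := by rw [show (C (2 : K)) = 2 from map_ofNat C 2, map_ofNat]
      have e : φ (C 2 * A) / φ q = (φ A + φ B * w) / φ q + (φ A + φ B * -w) / φ q := by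
        rw [map_mul, h2]; ring
      rw [← hφ, e]
      exact h1
    exact two_u.dvd_mul_left.1 h2
  obtain ⟨A', rfl⟩ := hA
  have hA' : φ (q * A') / φ q = φ A' := by rw [map_mul]; field_simp
  have hB0 : IsIntegral K[X] (φ B * w / φ q) := by
    have h1 := hh.sub (isIntegral_algebraMap (x := A') : IsIntegral K[X] (φ A'))
    rwa [add_div, hA', add_sub_cancel_left] at h1
  have hB : q ∣ B := by
    refine dvd_of_sq_dvd (IsChartPoly.squarefree (g := g)) hq ?_
    refine dvd_of_isIntegral (L := FunField g) _ _ (pow_ne_zero 2 hq) ?_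
    have e : φ (B ^ 2 * g) / φ (q ^ 2) = (φ B * w / φ q) ^ 2 := by
      rw [map_mul, map_pow, map_pow, div_pow, mul_pow, hw2]
    rw [← hφ, e]
    exact hB0.pow 2
  obtain ⟨B', rfl⟩ := hB
  refine ⟨algebraMap _ _ A' + algebraMap _ _ B' * CoordRing.v g, ?_⟩
  rw [map_add, map_mul, htow, htow, ← hw, map_mul, map_mul]
  field_simp

instance : IsDedekindDomain (CoordRing g) where

/-- Evaluation of regular functions on the curve `v² = g(u)` at a point `(a, b)` of it. -/
def CoordRing.evalAt (a b : K) (h : b ^ 2 = g.eval a) : CoordRing g →+* K :=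
  AdjoinRoot.lift (evalRingHom a) b (by simp [h])

/-- The point `(a, b)` of the curve `v² = g(u)` as a nonzero prime of the coordinate ring:
the ideal of all regular functions vanishing at `(a, b)`. -/
def pointPrime (a b : K) (h : b ^ 2 = g.eval a) : HeightOneSpectrum (CoordRing g) where
  asIdeal := RingHom.ker (CoordRing.evalAt g a b h)
  isPrime := RingHom.ker_isPrime _
  ne_bot := by
    intro h0
    have h1 : algebraMap K[X] (CoordRing g) (X - C a) ∈ RingHom.ker (CoordRing.evalAt g a b h) := by
      rw [RingHom.mem_ker, AdjoinRoot.algebraMap_eq, CoordRing.evalAt, AdjoinRoot.lift_of]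
      simp
    rw [h0, Ideal.mem_bot, map_eq_zero_iff _ (algebraMap_chart_injective g)] at h1
    exact X_sub_C_ne_zero a h1

/-- The order of vanishing (negative at poles) of the rational function `φ` at the point `(a, b)`
of the curve `v² = g(u)`, with the junk value `0` for `φ = 0`. -/
def chartOrd (a b : K) (h : b ^ 2 = g.eval a) (φ : FunField g) : ℤ :=
  -WithZero.log ((pointPrime g a b h).valuation (FunField g) φ)

end Chart

end HyperellipticCurve

/-! ### Hyperelliptic curves of genus 3 -/

/-- A hyperelliptic curve `y² = f(x)` of genus 3 over a field `k` of characteristic `≠ 2`: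
`f` has degree 7 or 8 and no repeated roots over an algebraic closure. -/
structure HyperellipticCurve (k : Type*) [Field k] where
  f : k[X]
  two_ne_zero : (2 : k) ≠ 0
  separable : f.Separable
  natDegree_eq : f.natDegree = 7 ∨ f.natDegree = 8

namespace HyperellipticCurve

/-- The base change of a curve to a field extension. -/
def baseChange {k : Type*} [Field k] (X : HyperellipticCurve k) (K : Type*) [Field K]
    [Algebra k K] : HyperellipticCurve K where
  f := X.f.map (algebraMap k K)
  two_ne_zero := by
    have h := (map_ne_zero (algebraMap k K)).2 X.two_ne_zero
    rwa [map_ofNat] at h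
  separable := X.separable.map
  natDegree_eq := by rw [natDegree_map]; exact X.natDegree_eq

variable {K : Type*} [Field K] (X : HyperellipticCurve K)

/-- The polynomial `z⁸ f(1/z)`. The curve is covered by the charts `y² = f(x)` and
`w² = fInf(z)`, glued along `z = 1/x`, `w = y/x⁴`. -/
def fInf : K[X] := reflect 8 X.f

lemma natDegree_le : X.f.natDegree ≤ 8 := by have := X.natDegree_eq; omega

lemma f_ne_zero : X.f ≠ 0 := by
  intro h
  have := X.natDegree_eq
  simp [h] at this

instance : IsChartPoly X.f where
  two_ne_zero := X.two_ne_zero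
  squarefree := X.separable.squarefree
  not_isUnit := fun h => by
    have h1 := natDegree_eq_zero_of_isUnit h
    have h2 := X.natDegree_eq
    omega

lemma coeff_fInf_zero : X.fInf.coeff 0 = X.f.coeff 8 := by
  rw [fInf, coeff_reflect, revAt_le (by norm_num)]

lemma coeff_fInf_one : X.fInf.coeff 1 = X.f.coeff 7 := by
  rw [fInf, coeff_reflect, revAt_le (by norm_num)]

lemma not_X_sq_dvd_fInf : ¬ ((Polynomial.X : K[X]) ^ 2 ∣ X.fInf) := by
  intro h
  have h0 := X_pow_dvd_iff.1 h 0 (by norm_num)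
  have h1 := X_pow_dvd_iff.1 h 1 (by norm_num)
  rw [coeff_fInf_zero] at h0
  rw [coeff_fInf_one] at h1
  have hl : X.f.leadingCoeff ≠ 0 := leadingCoeff_ne_zero.2 X.f_ne_zero
  rw [leadingCoeff] at hl
  rcases X.natDegree_eq with h | h <;> rw [h] at hl
  · exact hl h1
  · exact hl h0

lemma fInf_ne_zero : X.fInf ≠ 0 := by
  rw [fInf, Ne, reflect_eq_zero_iff]; exact X.f_ne_zero

lemma natDegree_fInf_le : X.fInf.natDegree ≤ 8 := by
  have h := natDegree_reflect_le (N := 8) (p := X.f)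
  rwa [max_eq_left X.natDegree_le] at h

lemma squarefree_fInf : Squarefree X.fInf := by
  rintro p ⟨q, hq⟩
  have hne : p * p * q ≠ 0 := hq ▸ X.fInf_ne_zero
  have hp : p ≠ 0 := left_ne_zero_of_mul (left_ne_zero_of_mul hne)
  have hq0 : q ≠ 0 := right_ne_zero_of_mul hne
  have hdeg : p.natDegree + p.natDegree + q.natDegree ≤ 8 := by
    have h := X.natDegree_fInf_le
    rwa [hq, natDegree_mul (mul_ne_zero hp hp) hq0, natDegree_mul hp hp] at h
  set d := p.natDegree with hd
  have hf : X.f = reflect d p * reflect d p * reflect (8 - (d + d)) q := by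
    rw [← reflect_mul p p le_rfl le_rfl, ← reflect_mul _ _ (by rw [natDegree_mul hp hp]) (by omega),
      ← hq, Nat.add_sub_cancel' (by omega), fInf, reflect_reflect]
  have hu : IsUnit (reflect d p) :=
    X.separable.squarefree _ ⟨_, hf⟩
  obtain ⟨c, hc, hcp⟩ := Polynomial.isUnit_iff.1 hu
  have hp' : p = C c * Polynomial.X ^ d := by
    rw [← reflect_C, hcp, reflect_reflect]
  rcases Nat.eq_zero_or_pos d with h0 | h0
  · rw [h0, pow_zero, mul_one] at hp'
    rw [hp']
    exact isUnit_C.2 hc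
  · exfalso
    refine X.not_X_sq_dvd_fInf ?_
    have h1 : (Polynomial.X : K[X]) ∣ p := by
      rw [hp']
      exact (dvd_pow_self _ h0.ne').mul_left _
    rw [hq, sq]
    exact (mul_dvd_mul h1 h1).mul_right q

instance : IsChartPoly X.fInf where
  two_ne_zero := X.two_ne_zero
  squarefree := X.squarefree_fInf
  not_isUnit := fun h => by
    obtain ⟨c, -, hc⟩ := Polynomial.isUnit_iff.1 h
    have hf : X.f = C c * Polynomial.X ^ 8 := by
      rw [← reflect_C, hc, fInf, reflect_reflect]
    have hX : IsUnit (Polynomial.X : K[X]) := by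
      refine X.separable.squarefree _ ⟨C c * Polynomial.X ^ 6, ?_⟩
      rw [hf]; ring
    exact not_isUnit_X hX

/-- The coordinate `z` as a rational function on the chart at infinity. -/
def zFun : FunField X.fInf := algebraMap (CoordRing X.fInf) _ (algebraMap K[X] _ Polynomial.X)

/-- The coordinate `w` as a rational function on the chart at infinity. -/
def wFun : FunField X.fInf := algebraMap (CoordRing X.fInf) _ (CoordRing.v X.fInf)

/-- The constants in the function field of the chart at infinity. -/
def constInf : K →+* FunField X.fInf :=
  (algebraMap (CoordRing X.fInf) _).comp ((algebraMap K[X] (CoordRing X.fInf)).comp C)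

lemma eval₂_zFun (p : K[X]) : p.eval₂ X.constInf X.zFun =
    algebraMap (CoordRing X.fInf) (FunField X.fInf) (algebraMap K[X] _ p) := by
  rw [constInf, zFun, ← RingHom.comp_assoc, ← RingHom.comp_apply, ← hom_eval₂, eval₂_C_X]
  rfl

lemma eval₂_zFun_injective : Function.Injective fun p : K[X] => p.eval₂ X.constInf X.zFun := by
  intro p q h
  simp only [eval₂_zFun] at h
  exact algebraMap_chart_injective _ (IsFractionRing.injective _ _ h)

lemma zFun_ne_zero : X.zFun ≠ 0 := by
  intro h
  have := X.eval₂_zFun_injective (a₁ := Polynomial.X) (a₂ := 0) (by simp [h])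
  exact X_ne_zero this

lemma eval₂_inv_zFun_mul (p : K[X]) (n : ℕ) (hn : p.natDegree ≤ n) :
    p.eval₂ X.constInf X.zFun⁻¹ * X.zFun ^ n = (reflect n p).eval₂ X.constInf X.zFun := by
  let : Invertible X.zFun⁻¹ := invertibleOfNonzero (inv_ne_zero X.zFun_ne_zero)
  have h := eval₂_reflect_mul_pow X.constInf X.zFun⁻¹ n p hn
  rw [invOf_eq_inv, inv_inv] at h
  rw [← h, mul_assoc, ← mul_pow, inv_mul_cancel₀ X.zFun_ne_zero, one_pow, mul_one]

/-- The change of charts `x ↦ 1/z`, `y ↦ w/z⁴` on regular functions. -/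
def toInfRing : CoordRing X.f →+* FunField X.fInf :=
  AdjoinRoot.lift (eval₂RingHom X.constInf X.zFun⁻¹) (X.wFun / X.zFun ^ 4) (by
    have hz := X.zFun_ne_zero
    have h1 : X.wFun ^ 2 = X.fInf.eval₂ X.constInf X.zFun := by
      rw [eval₂_zFun, wFun, ← map_pow, CoordRing.v_sq]
    have h2 := X.eval₂_inv_zFun_mul X.f 8 X.natDegree_le
    rw [← fInf, ← h1] at h2
    rw [eval₂_sub, eval₂_pow, eval₂_X, eval₂_C, coe_eval₂RingHom, div_pow, ← h2]
    field_simp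
    ring)

lemma toInfRing_injective : Function.Injective X.toInfRing := by
  rw [injective_iff_map_eq_zero]
  intro a ha
  have hbot : RingHom.ker X.toInfRing = ⊥ := by
    have : (RingHom.ker X.toInfRing).IsPrime := RingHom.ker_isPrime _
    refine Ideal.eq_bot_of_comap_eq_bot (R := K[X]) ?_
    rw [eq_bot_iff]
    intro p hp
    rw [Ideal.mem_comap, RingHom.mem_ker, AdjoinRoot.algebraMap_eq, toInfRing, AdjoinRoot.lift_of,
      coe_eval₂RingHom] at hp
    have h := X.eval₂_inv_zFun_mul p p.natDegree le_rfl
    rw [hp, zero_mul] at h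
    have h0 := X.eval₂_zFun_injective (a₁ := reflect p.natDegree p) (a₂ := 0) (by simp [← h])
    exact reflect_eq_zero_iff.1 h0
  exact (Ideal.mem_bot).1 (hbot ▸ (RingHom.mem_ker.2 ha))

/-- The change of charts `x ↦ 1/z`, `y ↦ w/z⁴` on rational functions. -/
def toInf : FunField X.f →+* FunField X.fInf := IsFractionRing.lift X.toInfRing_injective

/-- The `K`-points of the smooth projective curve with affine equation `y² = f(x)`: the affine
points `(x, y)`, and the points at infinity, that is, the points with `z = 0` of the second chart
`w² = fInf(z)`; note `fInf(0)` is the coefficient of `x⁸` in `f`. -/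
inductive Point : Type _
  | affine (x y : K) (h : y ^ 2 = X.f.eval x) : Point
  | infinite (w : K) (h : w ^ 2 = X.fInf.eval 0) : Point

/-- The hyperelliptic involution `ι`. -/
def invol : X.Point → X.Point
  | .affine x y h => .affine x (-y) (by rw [neg_sq, h])
  | .infinite w h => .infinite (-w) (by rw [neg_sq, h])

/-- The function field of the curve. -/
abbrev Fun : Type _ := FunField X.f

/-- The order of vanishing of a rational function at a point of the curve. -/
def ord : X.Point → X.Fun → ℤ
  | .affine x y h, φ => chartOrd X.f x y h φ
  | .infinite w h, φ => chartOrd X.fInf 0 w h (X.toInf φ)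

lemma ord_one (P : X.Point) : X.ord P 1 = 0 := by
  cases P <;> simp [ord, chartOrd]

lemma ord_mul (P : X.Point) {φ ψ : X.Fun} (hφ : φ ≠ 0) (hψ : ψ ≠ 0) :
    X.ord P (φ * ψ) = X.ord P φ + X.ord P ψ := by
  cases P with
  | affine x y h =>
    simp only [ord, chartOrd]
    rw [map_mul, WithZero.log_mul, neg_add] <;> simpa
  | infinite w h =>
    simp only [ord, chartOrd]
    rw [map_mul, map_mul, WithZero.log_mul, neg_add] <;> simpa

lemma ord_inv (P : X.Point) (φ : X.Fun) : X.ord P φ⁻¹ = -X.ord P φ := by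
  cases P <;> simp [ord, chartOrd, WithZero.log_inv]

/-- Divisors; the order `D ≤ E` is pointwise. For algebraically closed `K` these are the usual
divisors on the curve over `K`. -/
abbrev Div : Type _ := X.Point →₀ ℤ

/-- The divisor `(P)`. -/
def pt (P : X.Point) : X.Div := Finsupp.single P 1

/-- The degree of a divisor. -/
def deg : X.Div →+ ℤ := Finsupp.degree

/-- The subgroup of principal divisors. -/
def principal : AddSubgroup X.Div where
  carrier := {D | ∃ φ : X.Fun, φ ≠ 0 ∧ ∀ P, D P = X.ord P φ}
  zero_mem' := ⟨1, one_ne_zero, fun P => by rw [ord_one]; rfl⟩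
  add_mem' := by
    rintro D E ⟨φ, hφ, hD⟩ ⟨ψ, hψ, hE⟩
    exact ⟨φ * ψ, mul_ne_zero hφ hψ, fun P => by rw [ord_mul _ _ hφ hψ, ← hD, ← hE]; rfl⟩
  neg_mem' := by
    rintro D ⟨φ, hφ, hD⟩
    exact ⟨φ⁻¹, inv_ne_zero hφ, fun P => by rw [ord_inv, ← hD]; rfl⟩

/-- The divisor class group. -/
abbrev Pic : Type _ := X.Div ⧸ X.principal

/-- The class `[D]` of a divisor. -/
def cls : X.Div →+ X.Pic := QuotientAddGroup.mk' X.principal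

/-- The group of `K`-points of the Jacobian, for algebraically closed `K`: the group of classes
of divisors of degree 0. -/
def Jac : AddSubgroup X.Pic := X.deg.ker.map X.cls

/-- A divisor is in general position if it is effective and there is no point `P` with
`D ≥ (P) + (ι P)`. -/
def InGeneralPosition (D : X.Div) : Prop :=
  0 ≤ D ∧ ¬ ∃ P : X.Point, X.pt P + X.pt (X.invol P) ≤ D

lemma exists_infinite [IsAlgClosed K] : ∃ w : K, w ^ 2 = X.fInf.eval 0 :=
  IsAlgClosed.exists_pow_nat_eq _ two_pos

/-- A point at infinity: a square root of the coefficient of `x⁸` in `f` is chosen. -/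
def pInf [IsAlgClosed K] : X.Point := .infinite X.exists_infinite.choose X.exists_infinite.choose_spec

/-- The divisor `D_∞ = (∞₁) + (∞₂)`, where `∞₁` and `∞₂ = ι ∞₁` are the points at infinity. If
`deg f = 8` these are two distinct points; if `deg f = 7` then `∞₁ = ∞₂` is the unique point at
infinity `∞`, so that `D_∞ = 2 (∞)`. -/
def dInf [IsAlgClosed K] : X.Div := X.pt X.pInf + X.pt (X.invol X.pInf)

end HyperellipticCurve

end

/-!
Write `D ↦ ι D` for the action of the hyperelliptic involution on divisors. The function `x - a`
has divisor `(P) + (ι P) - D_∞`, where `P` lies over `x = a` (`ord_X_sub_C`), so `D + ι D` is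
linearly equivalent to `(deg D) D_∞` for every divisor `D` (`cls_add_inv`), and the
divisor of a polynomial in `x` always has the form `B + ι B` (`exists_ord_poly`). Only two facts
about spaces of rational functions enter, and both are elementary since a function that is regular
on the affine chart is `p(x) + q(x) y`.

* *Existence.* A class of degree `0` is `[A - B]` with `A`, `B` effective of the same degree `n`.
  The functions `p(x) + q(x) y` with `deg p ≤ n + 2` and `deg q ≤ n - 2` have poles bounded by
  `(n + 2) D_∞` and form a space of dimension at least `2n + 1`. Vanishing along the divisor
  `ι A + B` of degree `2n` is at most `2n` linear conditions because all residue fields are `K`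
  (`exists_submodule_ord_ge`), so some nonzero function `ψ` satisfies them
  (`exists_ord_ge_sub_dInf`). Then `div ψ + (n + 2) D_∞ - ι A - B` is effective of degree `4` and of
  class `[A - B] + 2 [D_∞]`; its degree is known since `div ψ + ι div ψ` is the divisor of the norm of
  `ψ`, a polynomial in `x` (`exists_div_algebraMap`). Each pair `(P) + (ι P)` it contains can be
  removed at the cost of one `D_∞`; two such pairs would make the class zero.

* *Exclusivity and uniqueness.* Let `D - m D_∞` and `E - n D_∞` be equivalent, of degree `0`, with
  `D` and `E` in general position and `m + n ≤ 3`. Then `D + ι E - (m + n) D_∞` is the divisor of a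
  function in `L(3 D_∞)`, hence of a polynomial in `x`, as `y` has too large a pole
  (`exists_eq_poly_of_ord_ge`). So `D + ι E` is a sum of pairs `(P) + (ι P)`, and as neither `D`
  nor `E` contains such a pair, comparing coefficients gives `D = E`
  (`InGeneralPosition.eq_of_cls_eq`). The case `(m, n) = (2, 1)` shows that (a) and (b) exclude each
  other, by comparing degrees, and the case `(1, 1)` is the uniqueness in (b).
-/

noncomputable section

namespace HyperellipticCurve

/-! ### Points and rational functions on an affine chart `v² = g(u)` -/

section Chart

variable {K : Type*} [Field K] (g : K[X])

/-- The function field of the curve `v² = g(u)` as an extension of the field of constants. -/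
def constFun : K →+* FunField g :=
  (algebraMap (CoordRing g) (FunField g)).comp ((algebraMap K[X] (CoordRing g)).comp C)

lemma CoordRing.evalAt_algebraMap (a b : K) (h : b ^ 2 = g.eval a) (p : K[X]) :
    CoordRing.evalAt g a b h (algebraMap K[X] (CoordRing g) p) = p.eval a := by
  rw [AdjoinRoot.algebraMap_eq, CoordRing.evalAt, AdjoinRoot.lift_of]
  rfl

lemma CoordRing.evalAt_v (a b : K) (h : b ^ 2 = g.eval a) :
    CoordRing.evalAt g a b h (CoordRing.v g) = b := by
  rw [CoordRing.evalAt, CoordRing.v, AdjoinRoot.lift_root]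

lemma mem_pointPrime (a b : K) (h : b ^ 2 = g.eval a) (r : CoordRing g) :
    r ∈ (pointPrime g a b h).asIdeal ↔ CoordRing.evalAt g a b h r = 0 :=
  RingHom.mem_ker

/-- The involution `(u, v) ↦ (u, -v)` as an automorphism of the coordinate ring. -/
def CoordRing.conjEquiv : CoordRing g ≃+* CoordRing g where
  toFun := CoordRing.conj g
  invFun := CoordRing.conj g
  left_inv := CoordRing.conj_conj g
  right_inv := CoordRing.conj_conj g
  map_mul' := map_mul _
  map_add' := map_add _

/-- The involution `(u, v) ↦ (u, -v)` on rational functions. -/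
def conjFun : FunField g ≃+* FunField g :=
  IsFractionRing.ringEquivOfRingEquiv (CoordRing.conjEquiv g)

lemma conjFun_algebraMap (r : CoordRing g) :
    conjFun g (algebraMap _ _ r) = algebraMap _ _ (CoordRing.conj g r) :=
  IsFractionRing.ringEquivOfRingEquiv_algebraMap _ r

lemma algebraMap_X_sub_C_mem_pointPrime (a b : K) (h : b ^ 2 = g.eval a) :
    algebraMap K[X] (CoordRing g) (X - C a) ∈ (pointPrime g a b h).asIdeal := by
  rw [mem_pointPrime, CoordRing.evalAt_algebraMap]; simp

lemma v_sub_mem_pointPrime (a b : K) (h : b ^ 2 = g.eval a) :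
    CoordRing.v g - algebraMap K[X] (CoordRing g) (C b) ∈ (pointPrime g a b h).asIdeal := by
  rw [mem_pointPrime, map_sub, CoordRing.evalAt_algebraMap, CoordRing.evalAt_v]; simp

/-- The maximal ideal of the point `(a, b)` is generated by `u - a` and `v - b`. -/
lemma exists_eq_of_mem_pointPrime (a b : K) (h : b ^ 2 = g.eval a) {r : CoordRing g}
    (hr : r ∈ (pointPrime g a b h).asIdeal) : ∃ s t : CoordRing g,
      r = algebraMap K[X] (CoordRing g) (X - C a) * s
        + (CoordRing.v g - algebraMap K[X] (CoordRing g) (C b)) * t := by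
  obtain ⟨p, q, rfl⟩ := CoordRing.exists_rep g r
  rw [mem_pointPrime, map_add, map_mul, CoordRing.evalAt_algebraMap, CoordRing.evalAt_algebraMap,
    CoordRing.evalAt_v] at hr
  have hroot : (p + q * C b).IsRoot a := by simpa using hr
  obtain ⟨s, hs⟩ := dvd_iff_isRoot.2 hroot
  refine ⟨algebraMap _ _ s, algebraMap _ _ q, ?_⟩
  rw [← map_mul, ← hs, map_add, map_mul]
  ring

lemma conj_mem_pointPrime (a b : K) (h : b ^ 2 = g.eval a) (h' : (-b) ^ 2 = g.eval a)
    (r : CoordRing g) : CoordRing.conj g r ∈ (pointPrime g a (-b) h').asIdeal ↔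
      r ∈ (pointPrime g a b h).asIdeal := by
  obtain ⟨p, q, rfl⟩ := CoordRing.exists_rep g r
  simp only [mem_pointPrime, map_add, map_mul, AlgHom.commutes, CoordRing.conj_v, map_neg,
    CoordRing.evalAt_algebraMap, CoordRing.evalAt_v, neg_neg]

lemma pointPrime_asIdeal_inj {a b a' b' : K} {h : b ^ 2 = g.eval a} {h' : b' ^ 2 = g.eval a'}
    (e : (pointPrime g a b h).asIdeal = (pointPrime g a' b' h').asIdeal) : a = a' ∧ b = b' := by
  have h1 := algebraMap_X_sub_C_mem_pointPrime g a b h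
  have h2 := v_sub_mem_pointPrime g a b h
  rw [e, mem_pointPrime, CoordRing.evalAt_algebraMap] at h1
  rw [e, mem_pointPrime, map_sub, CoordRing.evalAt_algebraMap, CoordRing.evalAt_v] at h2
  simp only [eval_sub, eval_X, eval_C, sub_eq_zero] at h1 h2
  exact ⟨h1.symm, h2.symm⟩

lemma conj_mem_pointPrime_pow (a b : K) (h : b ^ 2 = g.eval a) (h' : (-b) ^ 2 = g.eval a)
    (r : CoordRing g) (n : ℕ) : CoordRing.conj g r ∈ (pointPrime g a (-b) h').asIdeal ^ n ↔
      r ∈ (pointPrime g a b h).asIdeal ^ n := by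
  have e : (pointPrime g a b h).asIdeal.map (CoordRing.conjEquiv g) =
      (pointPrime g a (-b) h').asIdeal := by
    ext s
    rw [Ideal.mem_map_of_equiv]
    constructor
    · rintro ⟨t, ht, rfl⟩
      exact (conj_mem_pointPrime g a b h h' t).2 ht
    · intro hs
      refine ⟨CoordRing.conj g s, ?_, CoordRing.conj_conj g s⟩
      rwa [← conj_mem_pointPrime g a b h h', CoordRing.conj_conj]
  rw [← e, ← Ideal.map_pow, Ideal.mem_map_of_equiv]
  constructor
  · rintro ⟨t, ht, hts⟩
    rwa [← (CoordRing.conjEquiv g).injective hts]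
  · exact fun hr => ⟨r, hr, rfl⟩

variable [IsChartPoly g]

lemma algebraMap_X_sub_C_mem_pointPrime_mul (a b : K) (h : b ^ 2 = g.eval a)
    (h' : (-b) ^ 2 = g.eval a) :
    algebraMap K[X] (CoordRing g) (X - C a) ∈
      (pointPrime g a b h).asIdeal * (pointPrime g a (-b) h').asIdeal := by
  have hu := algebraMap_X_sub_C_mem_pointPrime g a b h
  have hu' := algebraMap_X_sub_C_mem_pointPrime g a (-b) h'
  have hv := v_sub_mem_pointPrime g a b h
  have hv' := v_sub_mem_pointPrime g a (-b) h'
  -- It suffices to exhibit a nonzero constant multiple of `u - a` in the product.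
  have key : ∀ c : K, c ≠ 0 → algebraMap K[X] (CoordRing g) ((X - C a) * C c) ∈
      (pointPrime g a b h).asIdeal * (pointPrime g a (-b) h').asIdeal →
      algebraMap K[X] (CoordRing g) (X - C a) ∈
        (pointPrime g a b h).asIdeal * (pointPrime g a (-b) h').asIdeal := by
    intro c hc hm
    have := Ideal.mul_mem_right (algebraMap K[X] (CoordRing g) (C c⁻¹)) _ hm
    rwa [← map_mul, mul_assoc, ← C_mul, mul_inv_cancel₀ hc, C_1, mul_one] at this
  by_cases hb : b = 0
  · subst hb
    have hroot : g.IsRoot a := by simpa using h.symm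
    obtain ⟨q, hq⟩ := dvd_iff_isRoot.2 hroot
    -- `a` is a simple root of `g`, so `q(a) ≠ 0`
    have hqa : q.eval a ≠ 0 := by
      intro h0
      obtain ⟨s, hs⟩ := dvd_iff_isRoot.2 (show q.IsRoot a from h0)
      exact not_isUnit_X_sub_C a
        (IsChartPoly.squarefree (g := g) _ ⟨s, by rw [hq, hs]; ring⟩)
    refine key _ hqa ?_
    obtain ⟨s, hs⟩ := X_sub_C_dvd_sub_C_eval (a := a) (p := q)
    have hqC : C (q.eval a) = q - (X - C a) * s := by rw [← hs]; ring
    rw [hqC]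
    have e : algebraMap K[X] (CoordRing g) ((X - C a) * (q - (X - C a) * s)) =
        (CoordRing.v g - algebraMap K[X] (CoordRing g) (C 0)) *
          (CoordRing.v g - algebraMap K[X] (CoordRing g) (C (-0)))
        - algebraMap K[X] (CoordRing g) (X - C a) * algebraMap K[X] (CoordRing g) (X - C a)
          * algebraMap K[X] (CoordRing g) s := by
      have hv2 : CoordRing.v g ^ 2 = algebraMap K[X] (CoordRing g) ((X - C a) * q) := by
        rw [CoordRing.v_sq, ← hq]
      simp only [map_mul, map_sub, map_zero, neg_zero, sub_zero] at hv2 ⊢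
      rw [← sq (CoordRing.v g), hv2]
      ring
    rw [e]
    exact Ideal.sub_mem _ (Ideal.mul_mem_mul hv hv')
      (Ideal.mul_mem_right _ _ (Ideal.mul_mem_mul hu hu'))
  · refine key (2 * b) (mul_ne_zero (IsChartPoly.two_ne_zero (g := g)) hb) ?_
    have e : algebraMap K[X] (CoordRing g) ((X - C a) * C (2 * b)) =
        algebraMap K[X] (CoordRing g) (X - C a) *
          (CoordRing.v g - algebraMap K[X] (CoordRing g) (C (-b)))
        - (CoordRing.v g - algebraMap K[X] (CoordRing g) (C b)) *
          algebraMap K[X] (CoordRing g) (X - C a) := by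
      simp only [map_mul, map_neg, map_sub, map_ofNat]
      ring
    rw [e]
    exact Ideal.sub_mem _ (Ideal.mul_mem_mul hu hv') (Ideal.mul_mem_mul hv hu')

/-- The fibre of `u` over `a` consists of `(a, b)` and `(a, -b)`, with multiplicity two if
`b = 0`. -/
lemma span_X_sub_C_eq (a b : K) (h : b ^ 2 = g.eval a) (h' : (-b) ^ 2 = g.eval a) :
    Ideal.span {algebraMap K[X] (CoordRing g) (X - C a)} =
      (pointPrime g a b h).asIdeal * (pointPrime g a (-b) h').asIdeal := by
  refine le_antisymm ?_ (Ideal.mul_le.2 fun r hr s hs => ?_)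
  · rw [Ideal.span_singleton_le_iff_mem]
    exact algebraMap_X_sub_C_mem_pointPrime_mul g a b h h'
  · obtain ⟨r₁, r₂, rfl⟩ := exists_eq_of_mem_pointPrime g a b h hr
    obtain ⟨s₁, s₂, rfl⟩ := exists_eq_of_mem_pointPrime g a (-b) h' hs
    rw [Ideal.mem_span_singleton]
    have hv : algebraMap K[X] (CoordRing g) (X - C a) ∣
        (CoordRing.v g - algebraMap K[X] (CoordRing g) (C b)) *
          (CoordRing.v g - algebraMap K[X] (CoordRing g) (C (-b))) := by
      have e : (CoordRing.v g - algebraMap K[X] (CoordRing g) (C b)) *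
          (CoordRing.v g - algebraMap K[X] (CoordRing g) (C (-b))) =
          algebraMap K[X] (CoordRing g) (g - C (g.eval a)) := by
        rw [← h, map_sub, ← CoordRing.v_sq]
        simp only [map_neg, map_pow]
        ring
      rw [e]
      exact map_dvd _ X_sub_C_dvd_sub_C_eval
    obtain ⟨w, hw⟩ := hv
    refine ⟨r₁ * (algebraMap K[X] (CoordRing g) (X - C a) * s₁
      + (CoordRing.v g - algebraMap K[X] (CoordRing g) (C (-b))) * s₂)
      + (CoordRing.v g - algebraMap K[X] (CoordRing g) (C b)) * r₂ * s₁ + w * r₂ * s₂, ?_⟩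
    linear_combination r₂ * s₂ * hw

lemma chartOrd_algebraMap (a b : K) (h : b ^ 2 = g.eval a) {r : CoordRing g} (hr : r ≠ 0) :
    chartOrd g a b h (algebraMap _ _ r) =
      multiplicity (pointPrime g a b h).asIdeal (Ideal.span {r}) := by
  rw [chartOrd, HeightOneSpectrum.valuation_of_algebraMap,
    HeightOneSpectrum.intValuation_eq_exp_neg_multiplicity _ hr, WithZero.log_exp, neg_neg]

lemma chartOrd_algebraMap_nonneg (a b : K) (h : b ^ 2 = g.eval a) (r : CoordRing g) :
    0 ≤ chartOrd g a b h (algebraMap _ _ r) := by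
  by_cases hr : r = 0
  · simp [hr, chartOrd]
  · rw [chartOrd_algebraMap g a b h hr]; positivity

lemma chartOrd_algebraMap_eq_zero (a b : K) (h : b ^ 2 = g.eval a) {r : CoordRing g}
    (hr : CoordRing.evalAt g a b h r ≠ 0) : chartOrd g a b h (algebraMap _ _ r) = 0 := by
  rw [chartOrd, (HeightOneSpectrum.valuation_eq_one_iff_notMem _).2, WithZero.log_one, neg_zero]
  rwa [mem_pointPrime]

lemma chartOrd_mul (a b : K) (h : b ^ 2 = g.eval a) {φ ψ : FunField g} (hφ : φ ≠ 0) (hψ : ψ ≠ 0) :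
    chartOrd g a b h (φ * ψ) = chartOrd g a b h φ + chartOrd g a b h ψ := by
  simp only [chartOrd]
  rw [map_mul, WithZero.log_mul, neg_add] <;> simpa

lemma chartOrd_div (a b : K) (h : b ^ 2 = g.eval a) {φ ψ : FunField g} (hφ : φ ≠ 0) (hψ : ψ ≠ 0) :
    chartOrd g a b h (φ / ψ) = chartOrd g a b h φ - chartOrd g a b h ψ := by
  have := chartOrd_mul g a b h (div_ne_zero hφ hψ) hψ
  rw [div_mul_cancel₀ φ hψ] at this
  omega

open Classical in
lemma multiplicity_pointPrime {a b a' b' : K} (h : b ^ 2 = g.eval a) (h' : b' ^ 2 = g.eval a') :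
    multiplicity (pointPrime g a b h).asIdeal (pointPrime g a' b' h').asIdeal =
      if a = a' ∧ b = b' then 1 else 0 := by
  split_ifs with hab
  · obtain ⟨rfl, rfl⟩ := hab
    exact multiplicity_self
  · refine multiplicity_eq_zero.2 fun hd => hab (pointPrime_asIdeal_inj g (h := h) (h' := h') ?_)
    exact ((pointPrime g a' b' h').isMaximal.eq_of_le (pointPrime g a b h).isPrime.ne_top
      (Ideal.dvd_iff_le.1 hd)).symm

open Classical in
/-- The divisor of `u - a` on the affine chart is `(a, b) + (a, -b)`. -/
lemma chartOrd_X_sub_C (a b : K) (h : b ^ 2 = g.eval a) (a' b' : K) (h' : b' ^ 2 = g.eval a') :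
    chartOrd g a' b' h' (algebraMap (CoordRing g) _ (algebraMap K[X] _ (X - C a))) =
      (if a' = a ∧ b' = b then 1 else 0) + (if a' = a ∧ b' = -b then 1 else 0) := by
  have hne : algebraMap K[X] (CoordRing g) (X - C a) ≠ 0 :=
    (map_ne_zero_iff _ (algebraMap_chart_injective g)).2 (X_sub_C_ne_zero a)
  have h'' : (-b) ^ 2 = g.eval a := by rw [neg_sq, h]
  rw [chartOrd_algebraMap g a' b' h' hne, span_X_sub_C_eq g a b h h'',
    multiplicity_mul (pointPrime g a' b' h').prime, multiplicity_pointPrime g h' h,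
    multiplicity_pointPrime g h' h'']
  · push_cast; rfl
  · exact FiniteMultiplicity.of_prime_left (pointPrime g a' b' h').prime
      (mul_ne_zero (pointPrime g a b h).prime.ne_zero (pointPrime g a (-b) h'').prime.ne_zero)

/-- Over an algebraically closed field, every closed point of the chart is a pair `(a, b)`. -/
lemma exists_eq_pointPrime [IsAlgClosed K] (w : HeightOneSpectrum (CoordRing g)) :
    ∃ (a b : K) (h : b ^ 2 = g.eval a), w = pointPrime g a b h := by
  have : w.asIdeal.IsPrime := w.isPrime
  have h0 : w.asIdeal.comap (algebraMap K[X] (CoordRing g)) ≠ ⊥ :=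
    mt Ideal.eq_bot_of_comap_eq_bot w.ne_bot
  have hp : (w.asIdeal.comap (algebraMap K[X] (CoordRing g))).IsPrime := inferInstance
  obtain ⟨p, hpI⟩ := IsPrincipalIdealRing.principal
    (w.asIdeal.comap (algebraMap K[X] (CoordRing g)))
  rw [hpI] at h0 hp
  have hp0 : p ≠ 0 := fun h => h0 (by simp [h])
  have hirr : Irreducible p := ((Ideal.span_singleton_prime hp0).1 hp).irreducible
  have hdeg : p.degree ≠ 0 := by
    rw [IsAlgClosed.degree_eq_one_of_irreducible K hirr]; exact one_ne_zero
  obtain ⟨a, ha⟩ := IsAlgClosed.exists_root p hdeg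
  have hdvd : p ∣ X - C a :=
    (irreducible_X_sub_C a).dvd_symm hirr (dvd_iff_isRoot.2 ha)
  have hmem : algebraMap K[X] (CoordRing g) (X - C a) ∈ w.asIdeal := by
    rw [← Ideal.mem_comap, hpI]
    exact Ideal.mem_span_singleton.2 hdvd
  obtain ⟨b, h⟩ := IsAlgClosed.exists_pow_nat_eq (g.eval a) two_pos
  have h' : (-b) ^ 2 = g.eval a := by rw [neg_sq, h]
  have hle : (pointPrime g a b h).asIdeal * (pointPrime g a (-b) h').asIdeal ≤ w.asIdeal := by
    rw [← span_X_sub_C_eq, Ideal.span_singleton_le_iff_mem]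
    exact hmem
  rcases w.isPrime.mul_le.1 hle with h1 | h1
  · exact ⟨a, b, h, HeightOneSpectrum.ext
      ((pointPrime g a b h).isMaximal.eq_of_le w.isPrime.ne_top h1).symm⟩
  · exact ⟨a, -b, h', HeightOneSpectrum.ext
      ((pointPrime g a (-b) h').isMaximal.eq_of_le w.isPrime.ne_top h1).symm⟩

/-- The residue field of a point is the field of constants. -/
lemma exists_valuation_sub_constFun_lt_one (a b : K) (h : b ^ 2 = g.eval a) {φ : FunField g}
    (hφ : (pointPrime g a b h).valuation (FunField g) φ ≤ 1) :
    ∃ c : K, (pointPrime g a b h).valuation (FunField g) (φ - constFun g c) < 1 := by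
  obtain ⟨r, hr⟩ := (pointPrime g a b h).exists_valuation_sub_lt_of_integer hφ 1
  refine ⟨CoordRing.evalAt g a b h r, ?_⟩
  have h1 : (pointPrime g a b h).valuation (FunField g)
      (algebraMap _ _ r - constFun g (CoordRing.evalAt g a b h r)) < 1 := by
    rw [constFun, RingHom.comp_apply, ← map_sub, HeightOneSpectrum.valuation_lt_one_iff_mem,
      mem_pointPrime, map_sub, RingHom.comp_apply, CoordRing.evalAt_algebraMap, eval_C, sub_self]
  have e : φ - constFun g (CoordRing.evalAt g a b h r) =
      (algebraMap _ _ r - constFun g (CoordRing.evalAt g a b h r)) - (algebraMap _ _ r - φ) := by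
    ring
  rw [e]
  exact ((pointPrime g a b h).valuation (FunField g)).map_sub_lt h1 hr

lemma valuation_constFun_le_one (a b : K) (h : b ^ 2 = g.eval a) (c : K) :
    (pointPrime g a b h).valuation (FunField g) (constFun g c) ≤ 1 :=
  HeightOneSpectrum.valuation_le_one _ _

/-- Orders are invariant under the involution. -/
lemma chartOrd_conjFun (a b : K) (h : b ^ 2 = g.eval a) (h' : (-b) ^ 2 = g.eval a)
    (φ : FunField g) : chartOrd g a (-b) h' (conjFun g φ) = chartOrd g a b h φ := by
  have key : ∀ r : CoordRing g, r ≠ 0 →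
      chartOrd g a (-b) h' (algebraMap _ _ (CoordRing.conj g r)) =
        chartOrd g a b h (algebraMap _ _ r) := by
    intro r hr
    have hr' : CoordRing.conj g r ≠ 0 := (map_ne_zero_iff _ (CoordRing.conjEquiv g).injective).2 hr
    rw [chartOrd_algebraMap g _ _ _ hr, chartOrd_algebraMap g _ _ _ hr', Nat.cast_inj]
    refine multiplicity_eq_of_emultiplicity_eq (emultiplicity_eq_emultiplicity_iff.2 fun n => ?_)
    rw [Ideal.dvd_span_singleton, Ideal.dvd_span_singleton, conj_mem_pointPrime_pow g a b h h']
  obtain ⟨r, s, hs, rfl⟩ := IsFractionRing.div_surjective (A := CoordRing g) φ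
  have hs : s ≠ 0 := nonZeroDivisors.ne_zero hs
  by_cases hr : r = 0
  · simp [hr, chartOrd]
  have inj : Function.Injective (algebraMap (CoordRing g) (FunField g)) :=
    IsFractionRing.injective _ _
  have hc : ∀ {t : CoordRing g}, t ≠ 0 → algebraMap _ (FunField g) (CoordRing.conj g t) ≠ 0 :=
    fun ht => (map_ne_zero_iff _ inj).2 ((map_ne_zero_iff _ (CoordRing.conjEquiv g).injective).2 ht)
  rw [map_div₀, conjFun_algebraMap, conjFun_algebraMap, chartOrd_div g _ _ _ (hc hr) (hc hs),
    chartOrd_div g _ _ _ ((map_ne_zero_iff _ inj).2 hr) ((map_ne_zero_iff _ inj).2 hs), key r hr,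
    key s hs]

end Chart

section Curve

variable {K : Type*} [Field K] (X : HyperellipticCurve K)

/-! ### Rational functions on the curve -/

/-- The constants in the function field of the curve. -/
def const : K →+* X.Fun := constFun X.f

/-- Polynomials in `x` as rational functions on the curve. -/
def poly : K[X] →+* X.Fun :=
  (algebraMap (CoordRing X.f) X.Fun).comp (algebraMap K[X] (CoordRing X.f))

/-- The coordinate `y` as a rational function on the curve. -/
def yFun : X.Fun := algebraMap (CoordRing X.f) X.Fun (CoordRing.v X.f)

/-- Pullback of rational functions along the hyperelliptic involution. -/
def conj : X.Fun ≃+* X.Fun := conjFun X.f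

lemma algebraMap_fun_injective : Function.Injective (algebraMap (CoordRing X.f) X.Fun) :=
  IsFractionRing.injective _ _

lemma poly_injective : Function.Injective X.poly :=
  X.algebraMap_fun_injective.comp (algebraMap_chart_injective X.f)

lemma poly_ne_zero {p : K[X]} (hp : p ≠ 0) : X.poly p ≠ 0 :=
  (map_ne_zero_iff _ X.poly_injective).2 hp

lemma poly_C (c : K) : X.poly (C c) = X.const c := rfl

lemma yFun_sq : X.yFun ^ 2 = X.poly X.f := by
  rw [yFun, ← map_pow, CoordRing.v_sq]; rfl

lemma yFun_ne_zero : X.yFun ≠ 0 := by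
  intro h
  have := X.yFun_sq
  rw [h, zero_pow _root_.two_ne_zero] at this
  exact X.poly_ne_zero X.f_ne_zero this.symm

lemma algebraMap_rep (p q : K[X]) : algebraMap (CoordRing X.f) X.Fun
    (algebraMap K[X] (CoordRing X.f) p + algebraMap K[X] (CoordRing X.f) q * CoordRing.v X.f) =
      X.poly p + X.poly q * X.yFun := by
  rw [map_add, map_mul]; rfl

lemma conj_poly (p : K[X]) : X.conj (X.poly p) = X.poly p := by
  rw [poly, RingHom.comp_apply, conj, conjFun_algebraMap, AlgHom.commutes]

lemma conj_yFun : X.conj X.yFun = -X.yFun := by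
  rw [yFun, conj, conjFun_algebraMap, CoordRing.conj_v, map_neg]

lemma two_ne_zero_fun : (2 : X.Fun) ≠ 0 := by
  have := X.poly_ne_zero (C_ne_zero.2 X.two_ne_zero)
  rwa [map_ofNat, map_ofNat] at this

/-- `1` and `y` are linearly independent over the field of rational functions in `x`. -/
lemma poly_add_poly_mul_yFun_eq_zero {p q : K[X]} (h : X.poly p + X.poly q * X.yFun = 0) :
    p = 0 ∧ q = 0 := by
  have h' := congrArg X.conj h
  rw [map_add, map_mul, conj_poly, conj_poly, conj_yFun, map_zero] at h'
  have h2 : 2 * X.poly p = 0 := by linear_combination h + h'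
  have hp := (mul_eq_zero.1 h2).resolve_left X.two_ne_zero_fun
  rw [hp, zero_add] at h
  have hq := (mul_eq_zero.1 h).resolve_right X.yFun_ne_zero
  exact ⟨(map_eq_zero_iff _ X.poly_injective).1 hp, (map_eq_zero_iff _ X.poly_injective).1 hq⟩

lemma toInf_algebraMap (r : CoordRing X.f) : X.toInf (algebraMap _ _ r) = X.toInfRing r :=
  IsFractionRing.lift_algebraMap _ _

lemma toInf_poly (p : K[X]) : X.toInf (X.poly p) = p.eval₂ X.constInf X.zFun⁻¹ := by
  rw [poly, RingHom.comp_apply, toInf_algebraMap, AdjoinRoot.algebraMap_eq, toInfRing,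
    AdjoinRoot.lift_of, coe_eval₂RingHom]

lemma toInf_yFun : X.toInf X.yFun = X.wFun / X.zFun ^ 4 := by
  rw [yFun, toInf_algebraMap, toInfRing, CoordRing.v, AdjoinRoot.lift_root]

lemma toInf_const (c : K) : X.toInf (X.const c) = constFun X.fInf c := by
  rw [← poly_C, toInf_poly, eval₂_C]; rfl

lemma conjFun_constInf (c : K) : conjFun X.fInf (X.constInf c) = X.constInf c := by
  rw [constInf, RingHom.comp_apply, conjFun_algebraMap, RingHom.comp_apply, AlgHom.commutes]

lemma conjFun_zFun : conjFun X.fInf X.zFun = X.zFun := by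
  rw [zFun, conjFun_algebraMap, AlgHom.commutes]

lemma conjFun_wFun : conjFun X.fInf X.wFun = -X.wFun := by
  rw [wFun, conjFun_algebraMap, CoordRing.conj_v, map_neg]

lemma toInf_conj (φ : X.Fun) : X.toInf (X.conj φ) = conjFun X.fInf (X.toInf φ) := by
  have key : ∀ r : CoordRing X.f, X.toInf (X.conj (algebraMap _ _ r)) =
      conjFun X.fInf (X.toInf (algebraMap _ _ r)) := by
    intro r
    obtain ⟨p, q, rfl⟩ := CoordRing.exists_rep X.f r
    have hp : ∀ p : K[X], conjFun X.fInf (X.toInf (X.poly p)) = X.toInf (X.poly p) := by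
      intro p
      rw [toInf_poly]
      have := hom_eval₂ p X.constInf (conjFun X.fInf : _ →+* FunField X.fInf) X.zFun⁻¹
      simp only [RingHom.coe_coe, map_inv₀, conjFun_zFun] at this
      rw [this]
      congr 1
      ext c
      exact X.conjFun_constInf c
    have hy : conjFun X.fInf (X.toInf X.yFun) = -X.toInf X.yFun := by
      rw [toInf_yFun, map_div₀, map_pow, conjFun_wFun, conjFun_zFun, neg_div]
    rw [algebraMap_rep]
    simp only [map_add, map_mul, conj_poly, conj_yFun, map_neg, hp, hy]
  obtain ⟨r, s, -, rfl⟩ := IsFractionRing.div_surjective (A := CoordRing X.f) φ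
  rw [map_div₀, map_div₀, key, key, map_div₀, map_div₀]

/-- The norm of a regular function to `K[x]`. -/
lemma exists_mul_conj_eq_poly (r : CoordRing X.f) : ∃ p : K[X],
    algebraMap (CoordRing X.f) X.Fun r * X.conj (algebraMap (CoordRing X.f) X.Fun r) =
      X.poly p := by
  obtain ⟨p, q, rfl⟩ := CoordRing.exists_rep X.f r
  refine ⟨p ^ 2 - q ^ 2 * X.f, ?_⟩
  rw [algebraMap_rep, map_add, map_mul, conj_poly, conj_poly, conj_yFun, map_sub, map_mul,
    map_pow, map_pow, ← yFun_sq]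
  ring

/-! ### Orders of vanishing -/

/-- The valuation of the function field at a point of the curve. -/
def val : X.Point → Valuation X.Fun ℤᵐ⁰
  | .affine x y h => (pointPrime X.f x y h).valuation X.Fun
  | .infinite w h => ((pointPrime X.fInf 0 w h).valuation (FunField X.fInf)).comap X.toInf

lemma ord_eq_neg_log (P : X.Point) (φ : X.Fun) : X.ord P φ = -WithZero.log (X.val P φ) := by
  cases P <;> rfl

lemma val_eq_exp (P : X.Point) {φ : X.Fun} (hφ : φ ≠ 0) :
    X.val P φ = WithZero.exp (-X.ord P φ) := by
  rw [ord_eq_neg_log, neg_neg, WithZero.exp_log]; simpa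

lemma le_ord_iff (P : X.Point) {φ : X.Fun} (hφ : φ ≠ 0) (m : ℤ) :
    m ≤ X.ord P φ ↔ X.val P φ ≤ WithZero.exp (-m) := by
  rw [val_eq_exp X P hφ, WithZero.exp_le_exp, neg_le_neg_iff]

lemma val_const_le_one (P : X.Point) (c : K) : X.val P (X.const c) ≤ 1 := by
  cases P with
  | affine x y h => exact valuation_constFun_le_one _ _ _ h c
  | infinite w h =>
    change (pointPrime X.fInf 0 w h).valuation (FunField X.fInf) (X.toInf (X.const c)) ≤ 1
    rw [toInf_const]
    exact valuation_constFun_le_one _ _ _ h c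

lemma exists_val_sub_const_lt_one (P : X.Point) {φ : X.Fun} (hφ : X.val P φ ≤ 1) :
    ∃ c, X.val P (φ - X.const c) < 1 := by
  cases P with
  | affine x y h => exact exists_valuation_sub_constFun_lt_one _ _ _ h hφ
  | infinite w h =>
    obtain ⟨c, hc⟩ := exists_valuation_sub_constFun_lt_one _ _ _ h hφ
    refine ⟨c, ?_⟩
    change (pointPrime X.fInf 0 w h).valuation (FunField X.fInf) (X.toInf (φ - X.const c)) < 1
    rwa [map_sub, toInf_const]

lemma ord_const (P : X.Point) {c : K} (hc : c ≠ 0) : X.ord P (X.const c) = 0 := by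
  have h : ∀ c : K, c ≠ 0 → 0 ≤ X.ord P (X.const c) := by
    intro c hc
    rw [le_ord_iff X P ((_root_.map_ne_zero _).2 hc), neg_zero, WithZero.exp_zero]
    exact X.val_const_le_one P c
  have h1 := h c hc
  have h2 := h c⁻¹ (inv_ne_zero hc)
  rw [map_inv₀, ord_inv] at h2
  omega

lemma le_ord_add (P : X.Point) {φ ψ : X.Fun} (m : ℤ) (hφ : φ ≠ 0 → m ≤ X.ord P φ)
    (hψ : ψ ≠ 0 → m ≤ X.ord P ψ) (h : φ + ψ ≠ 0) : m ≤ X.ord P (φ + ψ) := by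
  have key : ∀ χ : X.Fun, (χ ≠ 0 → m ≤ X.ord P χ) → X.val P χ ≤ WithZero.exp (-m) := by
    intro χ hχ
    by_cases h0 : χ = 0
    · simp [h0]
    · exact (X.le_ord_iff P h0 m).1 (hχ h0)
  exact (X.le_ord_iff P h m).2 ((X.val P).map_add_le (key φ hφ) (key ψ hψ))

lemma ord_algebraMap_nonneg (x y : K) (h : y ^ 2 = X.f.eval x) (r : CoordRing X.f) :
    0 ≤ X.ord (.affine x y h) (algebraMap _ _ r) :=
  chartOrd_algebraMap_nonneg X.f x y h r

lemma invol_invol (P : X.Point) : X.invol (X.invol P) = P := by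
  cases P <;> simp [invol]

lemma ord_invol_conj (P : X.Point) (φ : X.Fun) : X.ord (X.invol P) (X.conj φ) = X.ord P φ := by
  cases P with
  | affine x y h => exact chartOrd_conjFun _ _ _ h _ φ
  | infinite w h =>
    change chartOrd X.fInf 0 (-w) _ (X.toInf (X.conj φ)) = _
    rw [toInf_conj]
    exact chartOrd_conjFun _ _ _ h _ _

lemma ord_conj (P : X.Point) (φ : X.Fun) : X.ord P (X.conj φ) = X.ord (X.invol P) φ := by
  rw [← X.ord_invol_conj (X.invol P), invol_invol]

/-! ### Divisors and the involution -/

/-- The action of the hyperelliptic involution on divisors. -/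
def inv : X.Div →+ X.Div := Finsupp.mapDomain.addMonoidHom X.invol

lemma inv_apply (D : X.Div) (P : X.Point) : X.inv D P = D (X.invol P) := by
  have h := Finsupp.mapDomain_apply (Function.LeftInverse.injective X.invol_invol) D (X.invol P)
  rwa [invol_invol] at h

lemma inv_pt (P : X.Point) : X.inv (X.pt P) = X.pt (X.invol P) :=
  Finsupp.mapDomain_single

lemma deg_pt (P : X.Point) : X.deg (X.pt P) = 1 := Finsupp.degree_single P 1

lemma deg_inv (D : X.Div) : X.deg (X.inv D) = X.deg D := by
  have h : X.deg.comp X.inv = X.deg := by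
    refine Finsupp.addHom_ext fun P n => ?_
    change Finsupp.degree (Finsupp.mapDomain X.invol (Finsupp.single P n)) = Finsupp.degree _
    rw [Finsupp.mapDomain_single, Finsupp.degree_single, Finsupp.degree_single]
  exact DFunLike.congr_fun h D

lemma inv_nonneg {D : X.Div} (hD : 0 ≤ D) : 0 ≤ X.inv D := by
  intro P; rw [inv_apply]; exact hD _

lemma deg_nonneg {D : X.Div} (hD : 0 ≤ D) : 0 ≤ X.deg D :=
  Finset.sum_nonneg fun P _ => hD P

lemma eq_zero_of_deg_eq_zero {D : X.Div} (hD : 0 ≤ D) (h : X.deg D = 0) : D = 0 := by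
  have h1 := (Finset.sum_eq_zero_iff_of_nonneg fun P _ => hD P).1 h
  ext P
  by_contra hP
  exact hP (h1 P (Finsupp.mem_support_iff.2 hP))

lemma pt_apply_self (P : X.Point) : X.pt P P = 1 := Finsupp.single_eq_same

lemma pt_nonneg (P : X.Point) : 0 ≤ X.pt P := Finsupp.single_nonneg.2 zero_le_one

open Classical in
lemma pt_apply (P Q : X.Point) : X.pt P Q = if P = Q then 1 else 0 := Finsupp.single_apply

lemma cls_eq_zero_of_ord {D : X.Div} {φ : X.Fun} (hφ : φ ≠ 0) (h : ∀ P, D P = X.ord P φ) :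
    X.cls D = 0 :=
  (QuotientAddGroup.eq_zero_iff D).2 ⟨φ, hφ, h⟩

lemma exists_ord_of_cls_eq {D E : X.Div} (h : X.cls D = X.cls E) :
    ∃ φ : X.Fun, φ ≠ 0 ∧ ∀ P, (D - E) P = X.ord P φ := by
  have h1 : X.cls (D - E) = 0 := by rw [map_sub, h, sub_self]
  exact (QuotientAddGroup.eq_zero_iff (D - E)).1 h1

variable [IsAlgClosed K]

lemma inv_dInf : X.inv X.dInf = X.dInf := by
  rw [dInf, map_add, inv_pt, inv_pt, invol_invol, add_comm]

lemma dInf_nonneg : 0 ≤ X.dInf := add_nonneg (X.pt_nonneg _) (X.pt_nonneg _)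

lemma deg_dInf : X.deg X.dInf = 2 := by
  rw [dInf, map_add, deg_pt, deg_pt]; rfl

lemma dInf_affine (x y : K) (h : y ^ 2 = X.f.eval x) : X.dInf (.affine x y h) = 0 := by
  rw [dInf, Finsupp.add_apply, pt_apply, pt_apply, if_neg, if_neg, add_zero] <;>
    simp [pInf, invol]

lemma one_le_dInf_pInf : 1 ≤ X.dInf X.pInf := by
  rw [dInf, Finsupp.add_apply, pt_apply_self]
  have := X.pt_nonneg (X.invol X.pInf) X.pInf
  rw [Finsupp.zero_apply] at this
  omega

/-- The function `z = 1/x` vanishes along `D_∞` on the chart at infinity. -/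
lemma chartOrd_zFun (w : K) (h : w ^ 2 = X.fInf.eval 0) :
    chartOrd X.fInf 0 w h X.zFun = X.dInf (.infinite w h) := by
  have h1 := chartOrd_X_sub_C X.fInf 0 _ X.exists_infinite.choose_spec 0 w h
  rw [C_0, sub_zero] at h1
  rw [zFun, h1, dInf, Finsupp.add_apply, pt_apply, pt_apply, pInf, invol]
  classical
  congr 1 <;> refine if_congr ?_ rfl rfl
  · rw [Point.infinite.injEq]; simp [eq_comm]
  · rw [Point.infinite.injEq]; simp [eq_comm]

lemma ord_infinite_X_sub_C (a w : K) (h : w ^ 2 = X.fInf.eval 0) :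
    X.ord (.infinite w h) (X.poly (Polynomial.X - C a)) = -X.dInf (.infinite w h) := by
  have hz := X.zFun_ne_zero
  have hu : chartOrd X.fInf 0 w h (algebraMap (CoordRing X.fInf) _
      (algebraMap K[X] _ (1 - C a * Polynomial.X))) = 0 := by
    refine chartOrd_algebraMap_eq_zero _ _ _ _ ?_
    rw [CoordRing.evalAt_algebraMap]
    simp
  have hu0 : algebraMap (CoordRing X.fInf) (FunField X.fInf)
      (algebraMap K[X] _ (1 - C a * Polynomial.X)) ≠ 0 := by
    refine (map_ne_zero_iff _ (IsFractionRing.injective _ _)).2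
      ((map_ne_zero_iff _ (algebraMap_chart_injective _)).2 fun h0 => ?_)
    have := congrArg (eval 0) h0
    simp at this
  have e : X.toInf (X.poly (Polynomial.X - C a)) = algebraMap (CoordRing X.fInf) _
      (algebraMap K[X] _ (1 - C a * Polynomial.X)) / X.zFun := by
    rw [toInf_poly, ← eval₂_zFun, eq_div_iff hz]
    simp only [eval₂_sub, eval₂_X, eval₂_C, eval₂_mul, eval₂_one]
    rw [sub_mul, inv_mul_cancel₀ hz]
  change chartOrd X.fInf 0 w h (X.toInf (X.poly (Polynomial.X - C a))) = _
  rw [e, chartOrd_div _ _ _ _ hu0 hz, hu, chartOrd_zFun, zero_sub]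

/-- The divisor of `x - a` is `(P) + (ι P) - D_∞`, where `P` is a point over `x = a`. -/
lemma ord_X_sub_C (a b : K) (h : b ^ 2 = X.f.eval a) (P : X.Point) :
    X.ord P (X.poly (Polynomial.X - C a)) =
      (X.pt (.affine a b h) + X.pt (X.invol (.affine a b h)) - X.dInf) P := by
  rw [Finsupp.sub_apply, Finsupp.add_apply, pt_apply, pt_apply]
  cases P with
  | affine x y h' =>
    rw [dInf_affine]
    refine (chartOrd_X_sub_C X.f a b h x y h').trans ?_
    rw [sub_zero]
    classical
    congr 1 <;> refine if_congr ?_ rfl rfl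
    · rw [Point.affine.injEq]; simp [eq_comm]
    · rw [invol, Point.affine.injEq]; simp [eq_comm]
  | infinite w h' =>
    rw [ord_infinite_X_sub_C]
    simp [invol]

lemma eq_pInf_or_eq_invol_pInf (w : K) (h : w ^ 2 = X.fInf.eval 0) :
    Point.infinite w h = X.pInf ∨ Point.infinite w h = X.invol X.pInf := by
  have h1 : w ^ 2 = X.exists_infinite.choose ^ 2 := by rw [h, X.exists_infinite.choose_spec]
  simpa [pInf, invol] using sq_eq_sq_iff_eq_or_eq_neg.1 h1

lemma one_le_dInf_infinite (w : K) (h : w ^ 2 = X.fInf.eval 0) : 1 ≤ X.dInf (.infinite w h) := by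
  rcases X.eq_pInf_or_eq_invol_pInf w h with h2 | h2 <;> rw [h2]
  · exact X.one_le_dInf_pInf
  · rw [← inv_apply, inv_dInf]
    exact X.one_le_dInf_pInf

/-- Any two points exchanged by the involution form a divisor linearly equivalent to `D_∞`. -/
lemma cls_pt_add_pt_invol (P : X.Point) : X.cls (X.pt P + X.pt (X.invol P)) = X.cls X.dInf := by
  cases P with
  | affine a b h =>
    rw [← sub_eq_zero, ← map_sub]
    exact X.cls_eq_zero_of_ord (X.poly_ne_zero (X_sub_C_ne_zero a))
      fun P => (X.ord_X_sub_C a b h P).symm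
  | infinite w h =>
    rcases X.eq_pInf_or_eq_invol_pInf w h with h2 | h2
    · rw [h2, dInf]
    · rw [h2, invol_invol, add_comm, dInf]

lemma cls_add_inv (D : X.Div) : X.cls (D + X.inv D) = X.deg D • X.cls X.dInf := by
  have h : X.cls.comp (AddMonoidHom.id _ + X.inv) = (zmultiplesHom _ (X.cls X.dInf)).comp X.deg := by
    refine Finsupp.addHom_ext fun P n => ?_
    have e : (Finsupp.single P n : X.Div) = n • X.pt P := by
      rw [pt, Finsupp.smul_single, smul_eq_mul, mul_one]
    rw [e, map_zsmul, map_zsmul]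
    congr 1
    change X.cls (X.pt P + X.inv (X.pt P)) = X.deg (X.pt P) • X.cls X.dInf
    rw [inv_pt, cls_pt_add_pt_invol, deg_pt, one_smul]
  exact DFunLike.congr_fun h D

/-! ### Divisors of functions -/

/-- The divisor of a polynomial in `x` is the sum of a divisor of degree `0` and its conjugate. -/
lemma exists_ord_poly {p : K[X]} (hp : p ≠ 0) :
    ∃ B : X.Div, X.deg B = 0 ∧ (∀ P, X.ord P (X.poly p) = (B + X.inv B) P) ∧
      ∀ w h, X.ord (.infinite w h) (X.poly p) = -(p.natDegree * X.dInf (.infinite w h)) := by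
  induction hn : p.natDegree generalizing p with
  | zero =>
    obtain ⟨c, rfl⟩ := natDegree_eq_zero.1 hn
    have hc : c ≠ 0 := fun h => hp (by rw [h, C_0])
    have h0 : ∀ P, X.ord P (X.poly (C c)) = 0 := fun P => X.ord_const P hc
    refine ⟨0, map_zero _, fun P => ?_, fun w h => ?_⟩
    · rw [h0, map_zero, add_zero, Finsupp.zero_apply]
    · rw [h0]; simp
  | succ n ih =>
    obtain ⟨a, ha⟩ := IsAlgClosed.exists_root p (by
      rw [degree_eq_natDegree hp, hn]; exact_mod_cast n.succ_ne_zero)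
    obtain ⟨q, rfl⟩ := dvd_iff_isRoot.2 ha
    have hq : q ≠ 0 := right_ne_zero_of_mul hp
    have ha0 := X_sub_C_ne_zero a
    rw [natDegree_mul ha0 hq, natDegree_X_sub_C] at hn
    obtain ⟨B, hB, hBP, hBi⟩ := ih hq (by omega)
    obtain ⟨b, h⟩ := IsAlgClosed.exists_pow_nat_eq (X.f.eval a) two_pos
    refine ⟨X.pt (.affine a b h) - X.pt X.pInf + B, ?_, fun P => ?_, fun w h => ?_⟩
    · rw [map_add, map_sub, deg_pt, deg_pt, hB, sub_self, add_zero]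
    · rw [map_mul, ord_mul _ _ (X.poly_ne_zero ha0) (X.poly_ne_zero hq), hBP,
        X.ord_X_sub_C a b h, map_add, map_sub, inv_pt, inv_pt, dInf]
      simp only [Finsupp.add_apply, Finsupp.sub_apply]
      ring
    · rw [map_mul, ord_mul _ _ (X.poly_ne_zero ha0) (X.poly_ne_zero hq), hBi,
        ord_infinite_X_sub_C]
      push_cast
      ring

lemma ord_poly_infinite (w : K) (h : w ^ 2 = X.fInf.eval 0) {p : K[X]} (hp : p ≠ 0) :
    X.ord (.infinite w h) (X.poly p) = -(p.natDegree * X.dInf (.infinite w h)) :=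
  (X.exists_ord_poly hp).choose_spec.2.2 w h

lemma two_mul_ord_yFun_infinite (w : K) (h : w ^ 2 = X.fInf.eval 0) :
    2 * X.ord (.infinite w h) X.yFun = -(X.f.natDegree * X.dInf (.infinite w h)) := by
  rw [← ord_poly_infinite X w h X.f_ne_zero, ← yFun_sq, sq,
    ord_mul _ _ X.yFun_ne_zero X.yFun_ne_zero, two_mul]

/-- The divisor of a regular function on the affine curve has degree `0`: its sum with its
conjugate is the divisor of the norm, a polynomial in `x`. -/
lemma exists_div_algebraMap {r : CoordRing X.f} (hr : r ≠ 0) :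
    ∃ D : X.Div, X.deg D = 0 ∧ ∀ P, D P = X.ord P (algebraMap (CoordRing X.f) X.Fun r) := by
  have hφ : algebraMap (CoordRing X.f) X.Fun r ≠ 0 :=
    (map_ne_zero_iff _ X.algebraMap_fun_injective).2 hr
  obtain ⟨p, hp⟩ := X.exists_mul_conj_eq_poly r
  have hcr : algebraMap (CoordRing X.f) X.Fun (CoordRing.conj X.f r) =
    X.conj (algebraMap (CoordRing X.f) X.Fun r) := (conjFun_algebraMap X.f r).symm
  set φ := algebraMap (CoordRing X.f) X.Fun r with hφr
  have hφ' : X.conj φ ≠ 0 := (map_ne_zero_iff _ X.conj.injective).2 hφ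
  have hp0 : p ≠ 0 := by
    rintro rfl
    rw [map_zero] at hp
    exact mul_ne_zero hφ hφ' hp
  obtain ⟨B, hB, hBP, -⟩ := X.exists_ord_poly hp0
  have hsum : ∀ P, X.ord P φ + X.ord (X.invol P) φ = (B + X.inv B) P := by
    intro P
    rw [← ord_conj, ← ord_mul _ _ hφ hφ', hp, hBP]
  have hfin : (Function.support fun P => X.ord P φ).Finite := by
    refine ((B + X.inv B).support.finite_toSet.union
      X.dInf.support.finite_toSet).subset fun P hP => ?_
    cases P with
    | affine x y h =>
      refine Or.inl (Finsupp.mem_support_iff.2 ?_)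
      rw [← hsum, ← ord_conj, ← hcr]
      have h1 := X.ord_algebraMap_nonneg x y h r
      have h2 := X.ord_algebraMap_nonneg x y h (CoordRing.conj X.f r)
      have h3 : X.ord (.affine x y h) φ ≠ 0 := hP
      rw [← hφr] at h1
      omega
    | infinite w h =>
      refine Or.inr (Finsupp.mem_support_iff.2 ?_)
      have := X.one_le_dInf_infinite w h
      omega
  refine ⟨Finsupp.ofSupportFinite _ hfin, ?_, fun P => rfl⟩
  have h2 : Finsupp.ofSupportFinite _ hfin + X.inv (Finsupp.ofSupportFinite _ hfin) =
      B + X.inv B := by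
    ext P
    rw [Finsupp.add_apply, inv_apply, ← hsum]
    rfl
  have h3 := congrArg X.deg h2
  rw [map_add, map_add, deg_inv, deg_inv, hB] at h3
  omega

end Curve

section Curve

variable {K : Type*} [Field K] (X : HyperellipticCurve K)

/-! ### Vanishing conditions on spaces of functions -/

/-- Vanishing to one more order at a point is at most one linear condition. -/
lemma exists_submodule_ord_succ {V : Type*} [AddCommGroup V] [Module K V] [FiniteDimensional K V]
    (e : V →+ X.Fun) (he : Function.Injective e) (hsmul : ∀ c v, e (c • v) = X.const c * e v)
    (W : Submodule K V) (P : X.Point) (m : ℤ) (hW : ∀ v ∈ W, v ≠ 0 → m ≤ X.ord P (e v)) :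
    ∃ W' ≤ W, Module.finrank K W ≤ Module.finrank K W' + 1 ∧
      ∀ v ∈ W', v ≠ 0 → m + 1 ≤ X.ord P (e v) := by
  have he0 : ∀ {v}, v ≠ 0 → e v ≠ 0 := fun hv => (map_ne_zero_iff e he).2 hv
  have hconst : ∀ (c : K) (φ : X.Fun), X.val P (X.const c * φ) ≤ X.val P φ := fun c φ => by
    rw [map_mul]
    exact mul_le_of_le_one_left' (X.val_const_le_one P c)
  let W' : Submodule K V :=
    { carrier := {v | v ∈ W ∧ X.val P (e v) ≤ WithZero.exp (-(m + 1))}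
      zero_mem' := ⟨W.zero_mem, by simp⟩
      add_mem' := fun {v w} hv hw => ⟨W.add_mem hv.1 hw.1, by
        rw [map_add]; exact (X.val P).map_add_le hv.2 hw.2⟩
      smul_mem' := fun c v hv => ⟨W.smul_mem c hv.1, by
        rw [hsmul]; exact (hconst c _).trans hv.2⟩ }
  refine ⟨W', fun v hv => hv.1, ?_, fun v hv hv0 => (X.le_ord_iff P (he0 hv0) _).2 hv.2⟩
  by_cases hWW : W ≤ W'
  · exact (Submodule.finrank_mono hWW).trans (Nat.le_succ _)
  obtain ⟨v₀, hv₀, hv₀'⟩ := SetLike.not_le_iff_exists.1 hWW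
  have hv₀0 : v₀ ≠ 0 := fun h => hv₀' (h ▸ W'.zero_mem)
  -- `v₀` has order exactly `m`, and spans a complement of `W'` in `W`
  have hord : X.ord P (e v₀) = m := by
    refine le_antisymm ?_ (hW v₀ hv₀ hv₀0)
    by_contra hlt
    exact hv₀' ⟨hv₀, (X.le_ord_iff P (he0 hv₀0) _).1 (by omega)⟩
  have hval₀ : X.val P (e v₀) ≠ 0 := (Valuation.ne_zero_iff _).2 (he0 hv₀0)
  have hsup : W ≤ W' ⊔ Submodule.span K {v₀} := by
    intro v hv
    have hle : X.val P (e v / e v₀) ≤ 1 := by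
      rw [map_div₀]
      refine div_le_one_of_le₀ ?_ zero_le
      rw [X.val_eq_exp P (he0 hv₀0), hord]
      by_cases hv0 : v = 0
      · simp [hv0]
      · exact (X.le_ord_iff P (he0 hv0) m).1 (hW v hv hv0)
    obtain ⟨c, hc⟩ := X.exists_val_sub_const_lt_one P hle
    have hmem : v - c • v₀ ∈ W' := by
      refine ⟨W.sub_mem hv (W.smul_mem c hv₀), ?_⟩
      by_cases h0 : v - c • v₀ = 0
      · simp [h0]
      rw [← le_ord_iff X P (he0 h0)]
      have e1 : e (v - c • v₀) = (e v / e v₀ - X.const c) * e v₀ := by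
        rw [map_sub, hsmul, sub_mul, div_mul_cancel₀ _ (he0 hv₀0)]
      have hne : e v / e v₀ - X.const c ≠ 0 := fun h => he0 h0 (by rw [e1, h, zero_mul])
      rw [X.val_eq_exp P hne, ← WithZero.exp_zero, WithZero.exp_lt_exp] at hc
      rw [e1, ord_mul _ _ hne (he0 hv₀0), hord]
      omega
    rw [← sub_add_cancel v (c • v₀)]
    exact Submodule.add_mem_sup hmem (Submodule.smul_mem _ _ (Submodule.mem_span_singleton_self v₀))
  calc Module.finrank K W ≤ Module.finrank K ↥(W' ⊔ Submodule.span K {v₀}) :=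
        Submodule.finrank_mono hsup
    _ ≤ Module.finrank K W' + Module.finrank K ↥(Submodule.span K {v₀}) :=
        Submodule.finrank_add_le_finrank_add_finrank _ _
    _ = Module.finrank K W' + 1 := by rw [finrank_span_singleton hv₀0]

/-- Vanishing along an effective divisor `E` is at most `deg E` linear conditions. -/
lemma exists_submodule_ord_ge {V : Type*} [AddCommGroup V] [Module K V] [FiniteDimensional K V]
    (e : V →+ X.Fun) (he : Function.Injective e) (hsmul : ∀ c v, e (c • v) = X.const c * e v)
    (D : X.Div) (hD : ∀ v P, v ≠ 0 → D P ≤ X.ord P (e v)) (n : ℕ) (E : X.Div) (hE : 0 ≤ E)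
    (hn : X.deg E = n) :
    ∃ W : Submodule K V, Module.finrank K V ≤ Module.finrank K W + n ∧
      ∀ v ∈ W, v ≠ 0 → ∀ P, (D + E) P ≤ X.ord P (e v) := by
  induction n generalizing E with
  | zero =>
    have hE0 := X.eq_zero_of_deg_eq_zero hE (by exact_mod_cast hn)
    refine ⟨⊤, by simp, fun v _ hv P => ?_⟩
    rw [hE0, add_zero]
    exact hD v P hv
  | succ n ih =>
    obtain ⟨P, hP⟩ : ∃ P, E P ≠ 0 := by
      by_contra! h
      have h0 : E = 0 := Finsupp.ext h
      rw [h0, map_zero] at hn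
      have : (0 : ℤ) ≤ n := Nat.cast_nonneg n
      push_cast at hn
      omega
    have hEP : 0 ≤ E - X.pt P := by
      intro Q
      have h1 := hE Q
      rw [Finsupp.zero_apply] at h1
      rw [Finsupp.sub_apply, pt_apply, Finsupp.zero_apply]
      split_ifs with h
      · subst h; omega
      · omega
    obtain ⟨W, hW, hWo⟩ := ih (E - X.pt P) hEP (by rw [map_sub, hn, deg_pt]; push_cast; ring)
    obtain ⟨W', hle, hW', hWo'⟩ := X.exists_submodule_ord_succ e he hsmul W P
      ((D + (E - X.pt P)) P) fun v hv hv0 => hWo v hv hv0 P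
    refine ⟨W', by omega, fun v hv hv0 Q => ?_⟩
    by_cases hPQ : P = Q
    · subst hPQ
      have := hWo' v hv hv0
      rw [Finsupp.add_apply, Finsupp.sub_apply, pt_apply_self] at this
      rw [Finsupp.add_apply]
      omega
    · have := hWo v (hle hv) hv0 Q
      rw [Finsupp.add_apply, Finsupp.sub_apply, pt_apply, if_neg hPQ, sub_zero] at this
      rwa [Finsupp.add_apply]

/-! ### Divisors in general position -/

lemma InGeneralPosition.apply_le_one {D : X.Div} (hD : X.InGeneralPosition D) {P : X.Point}
    (hP : X.invol P = P) : D P ≤ 1 := by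
  by_contra hlt
  refine hD.2 ⟨P, fun Q => ?_⟩
  have := hD.1 Q
  rw [Finsupp.zero_apply] at this
  rw [hP, Finsupp.add_apply, pt_apply]
  split_ifs with h
  · subst h; omega
  · omega

lemma InGeneralPosition.apply_eq_zero_or {D : X.Div} (hD : X.InGeneralPosition D) {P : X.Point}
    (hP : X.invol P ≠ P) : D P = 0 ∨ D (X.invol P) = 0 := by
  by_contra! hne
  refine hD.2 ⟨P, fun Q => ?_⟩
  have h1 := hD.1 Q
  rw [Finsupp.zero_apply] at h1
  rw [Finsupp.add_apply, pt_apply, pt_apply]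
  split_ifs with h h' h'
  · exact absurd (h'.trans h.symm) hP
  · subst h; omega
  · subst h'; omega
  · omega

/-- If `D` and `E` are in general position and `D + ι E` is a sum of pairs `(P) + (ι P)`, then the
pairs can only match points of `D` with points of `ι E`. -/
lemma InGeneralPosition.eq_of_add_inv_eq {D E B : X.Div} (hD : X.InGeneralPosition D)
    (hE : X.InGeneralPosition E) (h : D + X.inv E = B + X.inv B) : D = E := by
  ext P
  have h1 := DFunLike.congr_fun h P
  have h2 := DFunLike.congr_fun h (X.invol P)
  simp only [Finsupp.add_apply, inv_apply, invol_invol] at h1 h2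
  have hD1 := hD.1 P
  have hD2 := hD.1 (X.invol P)
  have hE1 := hE.1 P
  have hE2 := hE.1 (X.invol P)
  rw [Finsupp.zero_apply] at hD1 hD2 hE1 hE2
  by_cases hP : X.invol P = P
  · have h3 := hD.apply_le_one X hP
    have h4 := hE.apply_le_one X hP
    rw [hP] at h1
    omega
  · have h3 := hD.apply_eq_zero_or X hP
    have h4 := hE.apply_eq_zero_or X hP
    omega

variable [IsAlgClosed K]

/-! ### Functions with poles bounded by multiples of `D_∞` -/

/-- A rational function without affine poles is regular on the affine chart. -/
lemma exists_eq_algebraMap_of_ord_nonneg {φ : X.Fun} (hφ : φ ≠ 0)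
    (h : ∀ x y hxy, 0 ≤ X.ord (.affine x y hxy) φ) :
    ∃ r : CoordRing X.f, algebraMap (CoordRing X.f) X.Fun r = φ := by
  refine HeightOneSpectrum.mem_integers_of_valuation_le_one (R := CoordRing X.f) X.Fun φ fun w => ?_
  obtain ⟨a, b, hab, rfl⟩ := exists_eq_pointPrime X.f w
  have h1 := (X.le_ord_iff (.affine a b hab) hφ 0).1 (h a b hab)
  rwa [neg_zero, WithZero.exp_zero] at h1

/-- The function `y` has poles of order at least `7/2` along `D_∞`, so that the space `L(3 D_∞)`
consists of polynomials in `x`. -/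
lemma exists_eq_poly_of_ord_ge {φ : X.Fun} (hφ : φ ≠ 0)
    (h : ∀ P, -(3 * X.dInf P) ≤ X.ord P φ) : ∃ p : K[X], p ≠ 0 ∧ φ = X.poly p := by
  obtain ⟨r, hr⟩ := X.exists_eq_algebraMap_of_ord_nonneg hφ fun x y hxy => by
    have := h (.affine x y hxy)
    rwa [dInf_affine, mul_zero, neg_zero] at this
  obtain ⟨p, q, rfl⟩ := CoordRing.exists_rep X.f r
  rw [algebraMap_rep] at hr
  by_cases hq : q = 0
  · rw [hq, map_zero, zero_mul, add_zero] at hr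
    exact ⟨p, fun hp => hφ (by rw [← hr, hp, map_zero]), hr.symm⟩
  exfalso
  -- the anti-invariant part `2 q y` of `φ` also has poles of order at most `3` along `D_∞`
  have hq2 : C 2 * q ≠ 0 := mul_ne_zero (C_ne_zero.2 X.two_ne_zero) hq
  have hdeg : (C 2 * q).natDegree = q.natDegree := natDegree_C_mul X.two_ne_zero
  have e : φ + -X.conj φ = X.poly (C 2 * q) * X.yFun := by
    rw [← hr]
    simp only [map_add, map_mul, conj_poly, conj_yFun]
    rw [show X.poly (C 2) = 2 by rw [map_ofNat, map_ofNat]]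
    ring
  have hne : φ + -X.conj φ ≠ 0 := by
    rw [e]
    exact mul_ne_zero (X.poly_ne_zero hq2) X.yFun_ne_zero
  have hconj : -(3 * X.dInf X.pInf) ≤ X.ord X.pInf (-X.conj φ) := by
    rw [ord_eq_neg_log, Valuation.map_neg, ← ord_eq_neg_log, ord_conj]
    have := h (X.invol X.pInf)
    rwa [← inv_apply, inv_dInf] at this
  have h1 := X.le_ord_add X.pInf _ (fun _ => h X.pInf) (fun _ => hconj) hne
  have h2 : X.ord X.pInf (X.poly (C 2 * q)) = -((C 2 * q).natDegree * X.dInf X.pInf) :=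
    X.ord_poly_infinite _ _ hq2
  have h3 : 2 * X.ord X.pInf X.yFun = -(X.f.natDegree * X.dInf X.pInf) :=
    X.two_mul_ord_yFun_infinite _ _
  rw [e, ord_mul _ _ (X.poly_ne_zero hq2) X.yFun_ne_zero, h2, hdeg] at h1
  have h4 := X.one_le_dInf_pInf
  have h5 : (7 : ℤ) ≤ X.f.natDegree := by
    have := X.natDegree_eq
    omega
  have h6 : (0 : ℤ) ≤ q.natDegree := Nat.cast_nonneg _
  nlinarith

/-- For an effective divisor `E` of degree `2n`, the space `L((n + 2) D_∞ - E)` is nonzero: the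
functions `p(x) + q(x) y` with `deg p ≤ n + 2` and `deg q ≤ n - 2` form a space of dimension at
least `2n + 1` inside `L((n + 2) D_∞)`. -/
lemma exists_ord_ge_sub_dInf (n : ℕ) (E : X.Div) (hE : 0 ≤ E) (hn : X.deg E = 2 * n) :
    ∃ r : CoordRing X.f, r ≠ 0 ∧ ∀ P, (E - (n + 2) • X.dInf) P ≤
      X.ord P (algebraMap (CoordRing X.f) X.Fun r) := by
  let e : (degreeLT K (n + 3) × degreeLT K (n - 1)) →+ X.Fun :=
    { toFun := fun v => X.poly v.1 + X.poly v.2 * X.yFun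
      map_zero' := by simp
      map_add' := fun v w => by
        simp only [Prod.fst_add, Prod.snd_add, Submodule.coe_add, map_add]; ring }
  have he : Function.Injective e := by
    refine (injective_iff_map_eq_zero e).2 fun v hv => ?_
    obtain ⟨h1, h2⟩ := X.poly_add_poly_mul_yFun_eq_zero hv
    exact Prod.ext (Subtype.ext h1) (Subtype.ext h2)
  have hsmul : ∀ c v, e (c • v) = X.const c * e v := by
    intro c v
    change X.poly (c • (v.1 : K[X])) + X.poly (c • (v.2 : K[X])) * X.yFun = X.const c *
      (X.poly v.1 + X.poly v.2 * X.yFun)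
    rw [smul_eq_C_mul, smul_eq_C_mul, map_mul, map_mul, poly_C]
    ring
  have hD : ∀ v P, v ≠ 0 → (-((n + 2) • X.dInf)) P ≤ X.ord P (e v) := by
    intro v P hv
    rw [Finsupp.neg_apply, Finsupp.smul_apply, nsmul_eq_mul]
    have hev : e v ≠ 0 := (map_ne_zero_iff e he).2 hv
    cases P with
    | affine x y h =>
      rw [dInf_affine, mul_zero, neg_zero]
      change 0 ≤ X.ord _ (X.poly v.1 + X.poly v.2 * X.yFun)
      rw [← algebraMap_rep]
      exact X.ord_algebraMap_nonneg x y h _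
    | infinite w h =>
      have hd := X.one_le_dInf_infinite w h
      refine X.le_ord_add _ _ (fun h1 => ?_) (fun h2 => ?_) hev
      · have hp : (v.1 : K[X]) ≠ 0 := fun h0 => h1 (by rw [h0, map_zero])
        have hdeg := (natDegree_lt_iff_degree_lt hp).2 (mem_degreeLT.1 v.1.2)
        rw [ord_poly_infinite X w h hp]
        have : ((v.1 : K[X]).natDegree : ℤ) ≤ (n + 2 : ℕ) := by exact_mod_cast Nat.le_of_lt_succ hdeg
        nlinarith
      · have hq : (v.2 : K[X]) ≠ 0 := fun h0 => h2 (by rw [h0, map_zero, zero_mul])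
        have hdeg := (natDegree_lt_iff_degree_lt hq).2 (mem_degreeLT.1 v.2.2)
        have hy := X.two_mul_ord_yFun_infinite w h
        rw [ord_mul _ _ (X.poly_ne_zero hq) X.yFun_ne_zero, ord_poly_infinite X w h hq]
        have h3 : ((v.2 : K[X]).natDegree : ℤ) + 2 ≤ n := by omega
        have h4 : (X.f.natDegree : ℤ) ≤ 8 := by exact_mod_cast X.natDegree_le
        push_cast
        nlinarith
  obtain ⟨W, hW, hWo⟩ := X.exists_submodule_ord_ge e he hsmul _ hD (2 * n) E hE
    (by rw [hn]; push_cast; rfl)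
  have hdim : Module.finrank K (degreeLT K (n + 3) × degreeLT K (n - 1)) = (n + 3) + (n - 1) := by
    rw [Module.finrank_prod, (degreeLTEquiv K _).finrank_eq, (degreeLTEquiv K _).finrank_eq,
      Module.finrank_fin_fun, Module.finrank_fin_fun]
  have hpos : W ≠ ⊥ := by
    rintro rfl
    rw [finrank_bot, hdim] at hW
    omega
  obtain ⟨v, hv, hv0⟩ := Submodule.exists_mem_ne_zero_of_ne_bot hpos
  refine ⟨algebraMap K[X] _ v.1 + algebraMap K[X] _ v.2 * CoordRing.v X.f, fun h0 => ?_,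
    fun P => ?_⟩
  · have h1 := X.algebraMap_rep v.1 v.2
    rw [h0, map_zero] at h1
    exact (map_ne_zero_iff e he).2 hv0 h1.symm
  · rw [algebraMap_rep, sub_eq_neg_add]
    exact hWo v hv hv0 P

/-! ### Divisor classes of degree zero -/

/-- Riemann's inequality for divisors of degree `4`: every class of degree `4` is effective. -/
lemma exists_effective_of_deg_eq_zero (D₀ : X.Div) (h₀ : X.deg D₀ = 0) :
    ∃ D : X.Div, 0 ≤ D ∧ X.deg D = 4 ∧ X.cls D = X.cls D₀ + 2 • X.cls X.dInf := by
  have hAB : D₀⁺ - D₀⁻ = D₀ := posPart_sub_negPart D₀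
  have hA : 0 ≤ D₀⁺ := posPart_nonneg D₀
  have hB : 0 ≤ D₀⁻ := negPart_nonneg D₀
  generalize D₀⁺ = A at hAB hA
  generalize D₀⁻ = B at hAB hB
  subst hAB
  obtain ⟨n, hn⟩ := Int.eq_ofNat_of_zero_le (X.deg_nonneg hA)
  rw [map_sub, sub_eq_zero] at h₀
  obtain ⟨r, hr, hro⟩ := X.exists_ord_ge_sub_dInf n (X.inv A + B) (add_nonneg (X.inv_nonneg hA) hB)
    (by rw [map_add, deg_inv, ← h₀, hn]; ring)
  obtain ⟨R, hR, hRo⟩ := X.exists_div_algebraMap hr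
  have hcls : X.cls R = 0 :=
    X.cls_eq_zero_of_ord ((map_ne_zero_iff _ X.algebraMap_fun_injective).2 hr) hRo
  refine ⟨R - (X.inv A + B - (n + 2) • X.dInf), ?_, ?_, ?_⟩
  · intro P
    have h1 := hro P
    rw [← hRo] at h1
    rw [Finsupp.sub_apply, Finsupp.zero_apply]
    omega
  · simp only [map_sub, map_add, map_nsmul, deg_inv, hR, ← h₀, hn, deg_dInf, nsmul_eq_mul]
    push_cast
    ring
  · have h1 := X.cls_add_inv A
    rw [map_add, hn] at h1
    have h2 : X.cls (X.inv A) = (n : ℤ) • X.cls X.dInf - X.cls A := by rw [← h1]; abel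
    simp only [map_sub, map_add, map_nsmul, hcls, h2, natCast_zsmul, add_smul]
    abel

/-- Linearly equivalent reduced divisors coincide. If `D - m D_∞ ∼ E - n D_∞`, then `D + ι E` is
linearly equivalent to `(m + n) D_∞`; for `m + n ≤ 3` it is therefore cut out by a polynomial in
`x`. -/
lemma InGeneralPosition.eq_of_cls_eq {D E : X.Div} (hD : X.InGeneralPosition D)
    (hE : X.InGeneralPosition E) {m n : ℕ} (hmn : m + n ≤ 3) (hn : X.deg E = 2 * n)
    (h : X.cls (D - m • X.dInf) = X.cls (E - n • X.dInf)) : D = E := by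
  have hcls : X.cls (D + X.inv E) = X.cls ((m + n) • X.dInf) := by
    have h1 := X.cls_add_inv E
    rw [map_add, hn] at h1
    have h2 : X.cls (X.inv E) = (2 * n : ℤ) • X.cls X.dInf - X.cls E := by rw [← h1]; abel
    rw [map_sub, map_sub, sub_eq_iff_eq_add] at h
    rw [map_add, h, h2, mul_smul, natCast_zsmul]
    simp only [map_nsmul, map_add, add_smul]
    abel
  obtain ⟨φ, hφ, hφo⟩ := X.exists_ord_of_cls_eq hcls
  obtain ⟨p, hp, rfl⟩ := X.exists_eq_poly_of_ord_ge hφ fun P => by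
    have h1 := hD.1 P
    have h2 := X.inv_nonneg hE.1 P
    have h3 := X.dInf_nonneg P
    have h4 : ((m + n : ℕ) : ℤ) ≤ 3 := by exact_mod_cast hmn
    rw [← hφo, Finsupp.sub_apply, Finsupp.smul_apply, nsmul_eq_mul, Finsupp.add_apply]
    rw [Finsupp.zero_apply] at h1 h2 h3
    nlinarith
  obtain ⟨B, -, hB, -⟩ := X.exists_ord_poly hp
  refine hD.eq_of_add_inv_eq X hE (B := B + (m + n) • X.pt X.pInf) ?_
  have h1 : D + X.inv E - (m + n) • X.dInf = B + X.inv B := by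
    ext P
    rw [hφo, hB]
  rw [sub_eq_iff_eq_add] at h1
  rw [h1, map_add, map_nsmul, inv_pt, dInf, smul_add]
  abel

/-- Every nonzero class of degree `0` is represented by a divisor in general position of degree
`4` or `2`: in an effective divisor of degree `4`, pairs `(P) + (ι P)` can be exchanged
for `D_∞`. -/
lemma exists_inGeneralPosition {D₀ : X.Div} (h₀ : X.deg D₀ = 0) (hne : X.cls D₀ ≠ 0) :
    (∃ D : X.Div, X.deg D = 4 ∧ X.InGeneralPosition D ∧ X.cls D₀ = X.cls (D - 2 • X.dInf)) ∨
      ∃ D : X.Div, X.deg D = 2 ∧ X.InGeneralPosition D ∧ X.cls D₀ = X.cls (D - X.dInf) := by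
  obtain ⟨D, hD, hdeg, hcls⟩ := X.exists_effective_of_deg_eq_zero D₀ h₀
  by_cases hgp : X.InGeneralPosition D
  · refine Or.inl ⟨D, hdeg, hgp, ?_⟩
    rw [map_sub, map_nsmul, hcls, add_sub_cancel_right]
  obtain ⟨P, hP⟩ := not_not.1 fun h => hgp ⟨hD, h⟩
  have hcls' : X.cls (D - (X.pt P + X.pt (X.invol P))) = X.cls D₀ + X.cls X.dInf := by
    rw [map_sub, cls_pt_add_pt_invol, hcls, two_smul]; abel
  have hdeg' : X.deg (D - (X.pt P + X.pt (X.invol P))) = 2 := by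
    rw [map_sub, map_add, deg_pt, deg_pt, hdeg]; rfl
  have hD' : 0 ≤ D - (X.pt P + X.pt (X.invol P)) := sub_nonneg.2 hP
  generalize D - (X.pt P + X.pt (X.invol P)) = D' at hcls' hdeg' hD'
  by_cases hgp' : X.InGeneralPosition D'
  · refine Or.inr ⟨D', hdeg', hgp', ?_⟩
    rw [map_sub, hcls', add_sub_cancel_right]
  obtain ⟨P', hP'⟩ := not_not.1 fun h => hgp' ⟨hD', h⟩
  have h0 : D' - (X.pt P' + X.pt (X.invol P')) = 0 :=
    X.eq_zero_of_deg_eq_zero (sub_nonneg.2 hP')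
      (by rw [map_sub, map_add, deg_pt, deg_pt, hdeg']; rfl)
  rw [sub_eq_zero.1 h0, cls_pt_add_pt_invol] at hcls'
  exact absurd (left_eq_add.1 (hcls'.trans (add_comm _ _))) hne

end Curve

end HyperellipticCurve

end

theorem mainTheorem6 {k : Type*} [Field k] (X : HyperellipticCurve k)
    (K : Type*) [Field K] [Algebra k K] [IsAlgClosed K]
    (Q : (X.baseChange K).Jac) (hQ : Q ≠ 0) :
    Xor
      (∃ D : (X.baseChange K).Div,
        (X.baseChange K).deg D = 4 ∧ (X.baseChange K).InGeneralPosition D ∧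
          (Q : (X.baseChange K).Pic) = (X.baseChange K).cls (D - 2 • (X.baseChange K).dInf))
      (∃ D : (X.baseChange K).Div,
        (X.baseChange K).deg D = 2 ∧ (X.baseChange K).InGeneralPosition D ∧
          (Q : (X.baseChange K).Pic) = (X.baseChange K).cls (D - (X.baseChange K).dInf)) ∧
    (∀ D E : (X.baseChange K).Div,
      (X.baseChange K).deg D = 2 → (X.baseChange K).InGeneralPosition D →
      (Q : (X.baseChange K).Pic) = (X.baseChange K).cls (D - (X.baseChange K).dInf) →
      (X.baseChange K).deg E = 2 → (X.baseChange K).InGeneralPosition E →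
      (Q : (X.baseChange K).Pic) = (X.baseChange K).cls (E - (X.baseChange K).dInf) →
      D = E) := by
  obtain ⟨q, D₀, hD₀, rfl⟩ := Q
  have hne : (X.baseChange K).cls D₀ ≠ 0 := fun h => hQ (Subtype.ext h)
  refine ⟨?_, fun D E _ hDg hD hE hEg hE' => ?_⟩
  · have hexcl : ¬ ((∃ D : (X.baseChange K).Div,
        (X.baseChange K).deg D = 4 ∧ (X.baseChange K).InGeneralPosition D ∧
          (X.baseChange K).cls D₀ = (X.baseChange K).cls (D - 2 • (X.baseChange K).dInf)) ∧
        (∃ D : (X.baseChange K).Div,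
        (X.baseChange K).deg D = 2 ∧ (X.baseChange K).InGeneralPosition D ∧
          (X.baseChange K).cls D₀ = (X.baseChange K).cls (D - (X.baseChange K).dInf))) := by
      rintro ⟨⟨D, hD, hDg, hDc⟩, E, hE, hEg, hEc⟩
      have hDE : D = E := hDg.eq_of_cls_eq (X.baseChange K) hEg (m := 2) (n := 1) le_rfl
        (by rw [hE]; rfl) (by rw [← hDc, one_smul, hEc])
      rw [hDE, hE] at hD
      norm_num at hD
    rcases (X.baseChange K).exists_inGeneralPosition hD₀ hne with h | h
    · exact Or.inl ⟨h, fun h' => hexcl ⟨h, h'⟩⟩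
    · exact Or.inr ⟨h, fun h' => hexcl ⟨h', h⟩⟩
  · exact hDg.eq_of_cls_eq (X.baseChange K) hEg (m := 1) (n := 1) (by norm_num)
      (by rw [hE]; rfl) (by rw [one_smul, ← hD, hE'])
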